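/- **Setting.** Let $\mathcal K\subseteq[0,1]^d$ be a closed convex set that is down-closed ($\mathbf 0\le \mathbf x\le \mathbf y\in\mathcal K$ implies $\mathbf x\in\mathcal K$), has more than one point, and let $\mathbf c\in\mathcal K$ and $r>0$ be such that every point of $\mathrm{aff}(\mathcal K)$ at Euclidean distance at most $r$ from $\mathbf c$ lies in $\mathcal K$. Put $\mathcal L_0=\mathrm{aff}(\mathcal K)-\mathbf c$ and $k=\dim\mathcal L_0$. Let $f_1,\dots,f_T:[0,1]^d\to\mathbb R_{\ge0}$ be a fixed sequence of differentiable DR-submodular functions ($\mathbf x\le\mathbf y$ in $[0,1]^d$ implies $\nabla f_t(\mathbf x)\ge\nabla f_t(\mathbf y)$ coordinatewise; no monotonicity is assumed) with $\|\nabla f_t\|\le M_1$ on $\mathcal K$. In round $t$ the player plays one action $\hat{\mathbf x}_t\in\mathcal K$ and makes one query, at a point $\mathbf q_t\in\mathcal K$, to a stochastic value oracle, which returns $o_t$ with $|o_t|\le B_0$ and conditional mean $f_t(\mathbf q_t)$, given the past and the player's samples of round $t$. **Algorithm (FOTZO applied to SO-OGA with BQND).** Fix $v>0$. Let $\delta=T^{-1/4}$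 (the smoothing radius), $\varphi(\mathbf x)=(1-\delta/r)(\mathbf x-\mathbf c)+\mathbf c$, $\hat{\mathcal K}=\varphi(\mathcal K)$, $\hat r=r-\delta$, $\epsilon=vT^{-1/2}$, $B_1=\frac k\delta B_0$ and $\eta=\frac{v\hat r}{2B_1}T^{-1/2}$; assume that $T\ge 1$ is so large that $\delta<r$ and $\epsilon<\hat r$. Let a measurable separation oracle for $\hat{\mathcal K}$ be given, which returns for each $\mathbf y\notin\hat{\mathcal K}$ a vector $\mathbf g$ with $\langle\mathbf g,\mathbf y-\mathbf x\rangle>0$ for all $\mathbf x\in\hat{\mathcal K}$. For $z\in[0,1]$ let $h_z(\mathbf x)=\mathbf 1-e^{-z\mathbf x}$ (coordinatewise). Start with $\mathbf x_1=\mathbf c$. In round $t$: 1. Let $\boldsymbol\xi_t=\varphi^{-1}(\mathbf x_t)\in\mathcal K$ and play $\hat{\mathbf x}_t=\varphi(h_1(\boldsymbol\xi_t))$. 2. Independently of each other and of the past, sample $z_t\in[0,1]$ with density $\frac{e^{z-1}}{1-e^{-1}}$ and $\mathbf u_t$ uniformly on the unit sphere of $\mathcal L_0$. Query the value oracle at $\mathbf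 q_t=\varphi(h_{z_t}(\boldsymbol\xi_t))+\delta\mathbf u_t$, receive $o_t$, and put $\mathbf g_t=\left(\tfrac k\delta o_t\mathbf u_t\right)\odot e^{-z_t\boldsymbol\xi_t}$. 3. Let $\mathbf x_{t+1}$ be the infeasible projection of $\mathbf x_t+\eta\mathbf g_t$, obtained as follows: project on $\mathrm{aff}(\hat{\mathcal K})$, then on the ball of $\mathrm{aff}(\hat{\mathcal K})$ with centre $\mathbf c$ and radius $\mathrm{diam}(\hat{\mathcal K})$; then, as long as the current point $\mathbf y$ is not in $\hat{\mathcal K}$, replace it by $\mathbf y-\epsilon\,\mathbf g'/\|\mathbf g'\|$, where $\mathbf g'$ is the orthogonal projection on $\mathcal L_0$ of the vector that the separation oracle returns at $\mathbf y$. **Claim.** The algorithm is well defined: almost surely all actions and all query points lie in $\mathcal K$, and each $f_t(\hat{\mathbf x}_t)$ is integrable. There is a constant $C$, depending only on $d$, $r$, $v$, $M_1$ and $B_0$, such that for all such $T$, all such $\mathcal K$, $\mathbf c$ and separation oracles, and all such functions and value oracles, $$\frac1e\max_{\mathbf y\in\mathcal K}\sum_{t=1}^Tf_t(\mathbf y)-\sum_{t=1}^T\mathbb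 E[f_t(\hat{\mathbf x}_t)]\le C\,T^{3/4}$$ and $$\max_{1\le a\le b\le T}\left\{\frac1e\max_{\mathbf y\in\mathcal K}\sum_{t=a}^bf_t(\mathbf y)-\sum_{t=a}^b\mathbb E[f_t(\hat{\mathbf x}_t)]\right\}\le C\,T^{3/4}.$$ -/

import Mathlib

open MeasureTheory ProbabilityTheory

noncomputable section

namespace DRSub

/-! ### Vectors, constraint sets and objective functions -/

/-- `ℝ^d` with the Euclidean norm. -/
abbrev Vec (d : ℕ) := EuclideanSpace ℝ (Fin d)

/-- The cube `[0,1]^d`. -/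
def unitCube (d : ℕ) : Set (Vec d) := {x | ∀ i, 0 ≤ x i ∧ x i ≤ 1}

/-- `0 ≤ x ≤ y` and `y ∈ K` imply `x ∈ K`. -/
def IsDownClosed {d : ℕ} (K : Set (Vec d)) : Prop :=
  ∀ y ∈ K, ∀ x : Vec d, (∀ i, 0 ≤ x i ∧ x i ≤ y i) → x ∈ K

/-- `f : [0,1]^d → ℝ_{≥ 0}` is non-negative, differentiable and DR-submodular (its gradient `g` is
antitone on the cube; no monotonicity of `f` is required), and `‖∇ f‖ ≤ M₁` on `K`.
The values of `f` outside the cube play no role. -/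
def IsDRSubmodular {d : ℕ} (K : Set (Vec d)) (M₁ : ℝ) (f : Vec d → ℝ) : Prop :=
  (∀ x ∈ unitCube d, 0 ≤ f x) ∧
  ∃ g : Vec d → Vec d,
    (∀ x ∈ unitCube d, HasGradientWithinAt f (g x) (unitCube d) x) ∧
    (∀ x ∈ unitCube d, ∀ y ∈ unitCube d, (∀ i, x i ≤ y i) → ∀ i, g y i ≤ g x i) ∧
    (∀ x ∈ K, ‖g x‖ ≤ M₁)

/-! ### The shrunk domain -/

/-- The affine map `x ↦ (1 - δ / r) (x - c) + c`. -/
def shrink {d : ℕ} (c : Vec d) (r δ : ℝ) (x : Vec d) : Vec d := (1 - δ / r) • (x - c) + c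

/-- The inverse of `shrink c r δ` (for `δ < r`). -/
def unshrink {d : ℕ} (c : Vec d) (r δ : ℝ) (x : Vec d) : Vec d := (1 - δ / r)⁻¹ • (x - c) + c

/-- The shrunk domain `{(1 - δ / r) (x - c) + c | x ∈ K}`. -/
def shrunkSet {d : ℕ} (K : Set (Vec d)) (c : Vec d) (r δ : ℝ) : Set (Vec d) :=
  shrink c r δ '' K

/-! ### Infeasible projection and online gradient ascent via a separation oracle (SO-OGA) -/

/-- A (Borel measurable) separation oracle: at every `y ∉ D` it returns a vector `g` with
`⟪g, y - x⟫ > 0` for all `x ∈ D`. -/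
def IsSeparationOracle {d : ℕ} (D : Set (Vec d)) (so : Vec d → Vec d) : Prop :=
  Measurable so ∧ ∀ y, y ∉ D → ∀ x ∈ D, 0 < inner ℝ (so y) (y - x)

/-- One pass through the loop of the infeasible projection:
`y ↦ y - ε g' / ‖g'‖`, with `g'` the projection of the separating vector on `aff D - c`. -/
def soipStep {d : ℕ} (D : Set (Vec d)) (so : Vec d → Vec d) (ε : ℝ) (y : Vec d) : Vec d :=
  y - (ε / ‖(vectorSpan ℝ D).starProjection (so y)‖) • (vectorSpan ℝ D).starProjection (so y)

/-- The starting point of the loop: `y₀` is projected on `aff D` (this gives `y₁`; here `c ∈ D`),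
then on the ball of `aff D` with centre `c` and radius `diam D`. -/
def soipStart {d : ℕ} (D : Set (Vec d)) (c y₀ : Vec d) : Vec d :=
  let y₁ := c + (vectorSpan ℝ D).starProjection (y₀ - c)
  c + (max 1 (‖y₁ - c‖ / Metric.diam D))⁻¹ • (y₁ - c)

/-- The infeasible projection SO-IP: the first point of the loop that lies in `D`. -/
def soip {d : ℕ} (D : Set (Vec d)) (c : Vec d) (so : Vec d → Vec d) (ε : ℝ) (y₀ : Vec d) : Vec d :=
  (soipStep D so ε)^[sInf {n : ℕ | (soipStep D so ε)^[n] (soipStart D c y₀) ∈ D}]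
    (soipStart D c y₀)

/-- The update of SO-OGA on the domain `D` with step size `η` and shrinking parameter `ε`:
a gradient ascent step along `g`, then the infeasible projection. -/
def soogaStep {d : ℕ} (D : Set (Vec d)) (c : Vec d) (so : Vec d → Vec d) (ε η : ℝ)
    (x g : Vec d) : Vec d :=
  soip D c so ε (x + η • g)

/-! ### The query algorithm BQND -/

/-- `h_z(x) = 1 - e^{-z x}`, coordinatewise. -/
def hMap {d : ℕ} (z : ℝ) (x : Vec d) : Vec d := WithLp.toLp 2 fun i => 1 - Real.exp (-(z * x i))

/-- `g ⊙ e^{-z x}`, coordinatewise. -/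
def expScale {d : ℕ} (z : ℝ) (x g : Vec d) : Vec d :=
  WithLp.toLp 2 fun i => g i * Real.exp (-(z * x i))

/-- The sampling law of `z` in BQND: density `e^{z - 1} / (1 - e^{-1})` on `[0,1]`. -/
def bqndLaw : Measure ℝ :=
  (volume.restrict (Set.Icc (0 : ℝ) 1)).withDensity
    fun z => ENNReal.ofReal (Real.exp (z - 1) / (1 - Real.exp (-1)))

/-- The map `h_z` on the shrunk domain, which is identified with `K` through `shrink c r δ`. -/
def hShrunk {d : ℕ} (c : Vec d) (r δ z : ℝ) (x : Vec d) : Vec d :=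
  shrink c r δ (hMap z (unshrink c r δ x))

/-- The output of BQND on the shrunk domain, at the point `x`, when `z` was sampled and the
first-order oracle returned `g`. -/
def bqndOutput {d : ℕ} (c : Vec d) (r δ z : ℝ) (x g : Vec d) : Vec d :=
  expScale z (unshrink c r δ x) g

/-! ### FOTZO applied to SO-OGA with BQND -/

/-- The uniform distribution on the unit sphere of the linear subspace `L₀`. -/
def uniformSphere {d : ℕ} (L₀ : Submodule ℝ (Vec d)) : Measure (Vec d) :=
  ((volume : Measure L₀).toSphere Set.univ)⁻¹ •
    ((volume : Measure L₀).toSphere).map fun u : Metric.sphere (0 : L₀) 1 => ((u : L₀) : Vec d)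

/-- The input of the algorithm: constraint set `K`, centre `c`, radius `r`, bound `B₀` on the output
of the value oracle, constant `v` of SO-OGA, horizon `T`, and a separation oracle `so` (for the
shrunk domain, on which SO-OGA is run). -/
structure Input (d : ℕ) where
  K : Set (Vec d)
  c : Vec d
  r : ℝ
  B₀ : ℝ
  v : ℝ
  T : ℕ
  so : Vec d → Vec d

namespace Input

variable {d : ℕ} (p : Input d)

/-- The smoothing radius `δ = T^{-1/4}` of FOTZO. -/
def δ : ℝ := (p.T : ℝ) ^ (-(1 / 4) : ℝ)

/-- The shrunk domain, passed to SO-OGA and BQND. -/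
def dom : Set (Vec d) := shrunkSet p.K p.c p.r p.δ

/-- The linear space `L₀ = aff K - c`. -/
def L₀ : Submodule ℝ (Vec d) := vectorSpan ℝ p.K

/-- `k = dim L₀`. -/
def k : ℕ := Module.finrank ℝ p.L₀

/-- The radius of the ball around `c` in the shrunk domain: `(1 - δ / r) r = r - δ`. -/
def rDom : ℝ := p.r - p.δ

/-- The bound `B₁ = (k / δ) B₀` on the gradient estimates. -/
def B₁ : ℝ := p.k / p.δ * p.B₀

/-- The shrinking parameter `v T^{-1/2}` of SO-OGA. -/
def ε : ℝ := p.v * (p.T : ℝ) ^ (-(1 / 2) : ℝ)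

/-- The step size `v r / (2 B₁) T^{-1/2}` of SO-OGA, for the radius of the shrunk domain. -/
def η : ℝ := p.v * p.rDom / (2 * p.B₁) * (p.T : ℝ) ^ (-(1 / 2) : ℝ)

/-- The points `x_t` of SO-OGA, for given samples `z`, `u` and given answers `o` of the value
oracle. FOTZO hands `(k / δ) o_t u_t` to BQND as the answer of a first-order oracle, and the output
of BQND is handed to SO-OGA. Rounds are numbered `0, …, T - 1`. -/
def iter (z : ℕ → ℝ) (u : ℕ → Vec d) (o : ℕ → ℝ) : ℕ → Vec d
  | 0 => p.c
  | t + 1 =>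
    soogaStep p.dom p.c p.so p.ε p.η (iter z u o t)
      (bqndOutput p.c p.r p.δ (z t) (iter z u o t) ((p.k / p.δ * o t) • u t))

/-- The action played in round `t`: `h(x_t)`, with `h = h_1` on the shrunk domain. -/
def action (z : ℕ → ℝ) (u : ℕ → Vec d) (o : ℕ → ℝ) (t : ℕ) : Vec d :=
  hShrunk p.c p.r p.δ 1 (p.iter z u o t)

/-- The point at which the value oracle is queried in round `t`: the query point `h_{z_t}(x_t)` of
BQND, perturbed by `δ u_t`. -/
def query (z : ℕ → ℝ) (u : ℕ → Vec d) (o : ℕ → ℝ) (t : ℕ) : Vec d :=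
  hShrunk p.c p.r p.δ (z t) (p.iter z u o t) + p.δ • u t

end Input

/-! ### Runs of the algorithm and regret -/

section Runs

variable {d : ℕ} {Ω : Type*} [MeasurableSpace Ω]

/-- The random action of round `t`. -/
def actionRV (p : Input d) (Z : ℕ → Ω → ℝ) (U : ℕ → Ω → Vec d) (O : ℕ → Ω → ℝ)
    (t : ℕ) (ω : Ω) : Vec d :=
  p.action (fun s => Z s ω) (fun s => U s ω) (fun s => O s ω) t

/-- The random query point of round `t`. -/
def queryRV (p : Input d) (Z : ℕ → Ω → ℝ) (U : ℕ → Ω → Vec d) (O : ℕ → Ω → ℝ)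
    (t : ℕ) (ω : Ω) : Vec d :=
  p.query (fun s => Z s ω) (fun s => U s ω) (fun s => O s ω) t

/-- The σ-algebra of the samples of round `t`. -/
abbrev sampleSigma (Z : ℕ → Ω → ℝ) (U : ℕ → Ω → Vec d) (t : ℕ) : MeasurableSpace Ω :=
  MeasurableSpace.comap (fun ω => (Z t ω, U t ω)) inferInstance

/-- The σ-algebra of all samples and oracle answers before round `t`. -/
abbrev pastSigma (Z : ℕ → Ω → ℝ) (U : ℕ → Ω → Vec d) (O : ℕ → Ω → ℝ) (t : ℕ) :
    MeasurableSpace Ω :=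
  ⨆ s, ⨆ _ : s < t, MeasurableSpace.comap (fun ω => (Z s ω, U s ω, O s ω)) inferInstance

/-- `Z`, `U`, `O` are the samples of BQND, the samples of FOTZO and the answers of the value oracles
in a run of the algorithm against the fixed sequence `f`: in each round `z_t` and `u_t` are drawn
from their laws, independently of each other and of the past, and the stochastic value oracle is
bounded by `B₀` and unbiased at the query point. -/
structure IsRun (p : Input d) (f : ℕ → Vec d → ℝ) (P : Measure Ω)
    (Z : ℕ → Ω → ℝ) (U : ℕ → Ω → Vec d) (O : ℕ → Ω → ℝ) : Prop where
  measurable_Z : ∀ t < p.T, Measurable (Z t)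
  measurable_U : ∀ t < p.T, Measurable (U t)
  measurable_O : ∀ t < p.T, Measurable (O t)
  law : ∀ t < p.T,
    P.map (fun ω => (Z t ω, U t ω)) = bqndLaw.prod (uniformSphere p.L₀)
  indep : ∀ t < p.T, Indep (sampleSigma Z U t) (pastSigma Z U O t) P
  bounded : ∀ t < p.T, ∀ᵐ ω ∂P, |O t ω| ≤ p.B₀
  unbiased : ∀ t < p.T,
    P[O t | pastSigma Z U O t ⊔ sampleSigma Z U t] =ᵐ[P] fun ω => f t (queryRV p Z U O t ω)

/-- The expected `α`-regret over the rounds in `I`, where `X t` is the (random) action of round `t`: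
`α max_{y ∈ K} ∑_{t ∈ I} f_t(y) - ∑_{t ∈ I} E[f_t(X_t)]`. -/
def regret (α : ℝ) (K : Set (Vec d)) (f : ℕ → Vec d → ℝ) (P : Measure Ω)
    (X : ℕ → Ω → Vec d) (I : Finset ℕ) : ℝ :=
  α * sSup ((fun y => ∑ t ∈ I, f t y) '' K) - ∑ t ∈ I, ∫ ω, f t (X t ω) ∂P

/-- The static `α`-regret over the horizon `T`. -/
def staticRegret (α : ℝ) (K : Set (Vec d)) (f : ℕ → Vec d → ℝ) (P : Measure Ω)
    (X : ℕ → Ω → Vec d) (T : ℕ) : ℝ :=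
  regret α K f P X (Finset.range T)

/-- The adaptive `α`-regret: the supremum of the regret over all intervals of rounds. -/
def adaptiveRegret (α : ℝ) (K : Set (Vec d)) (f : ℕ → Vec d → ℝ) (P : Measure Ω)
    (X : ℕ → Ω → Vec d) (T : ℕ) : ℝ :=
  sSup {R : ℝ | ∃ s e : ℕ, s ≤ e ∧ e < T ∧ R = regret α K f P X (Finset.Icc s e)}

end Runs

end DRSub

end

noncomputable section

namespace DRSub

/-! ### Divergence theorem for Lipschitz functions. -/

section Divergence

open Metric Set Filter Topology Module
open scoped NNReal

/-! The regret is reduced to that of online gradient ascent on random linear functions.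

Linearization (`HasDRGradient.exp_neg_one_mul_sub_le`). For DR-submodular F ≥ 0, the derivative of
e^{z-1} F(h_z(ξ)) in z is e^{z-1} (F(h_z(ξ)) + ⟨∇F(h_z(ξ)), e^{-zξ} ⊙ ξ⟩). Concavity along
non-negative directions gives F(h_z(ξ)) + ⟨∇F(h_z(ξ)), e^{-zξ} ⊙ y⟩ ≥ F(h_z(ξ) + e^{-zξ} ⊙ y) ≥
e^{-z} F(y). Integrating over [0,1] bounds e^{-1} F(y) - F(h_1(ξ)) by the average of ⟨∇F(h_z(ξ)),
e^{-zξ} ⊙ (y - ξ)⟩ under the law of z, up to the factor 1 - e^{-1}.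

One-point gradient estimate. For each x in the unit ball of L₀, φ(·) + δx is a homothety of the cube
into itself, so the linearization applies to f precomposed with it (`linearization_at`). Averaging
over x and using the divergence theorem (`setIntegral_ball_lineDeriv`) turns derivatives of f into
values of f on the sphere times ⟨u, ·⟩, which is the mean of the estimate (k/δ) o u. Since f is
controlled only on K, a globally Lipschitz extension F takes its place in the integrals.

Gradient ascent. A loop step of the infeasible projection decreases the distance to every point
whose ε-neighbourhood in the affine hull lies in the domain (`norm_soipStep_sub_sq_le`). The usual
telescoping of squared distances therefore works against such deep comparators. It may start in any
round, because the squared distance never exceeds d; this is why the same bound holds on all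
intervals. Moving an arbitrary comparator to a deep point of the shrunk domain, and perturbing by δ,
costs O(δ + ε) per round by the Lipschitz bound.

Randomness. The point x_t depends only on the past, so it is independent of the samples of round t,
and the oracle answer can be replaced by its conditional mean. With T = s⁴, one has δ = 1/s, ε of
order s⁻² and B₁ of order s, and every loss is at most of order s³. -/

theorem lineDeriv_cone {E : Type*} [NormedAddCommGroup E] [InnerProductSpace ℝ E] {s : ℝ} {x : E} (hx : x ≠ 0) (hxs : ‖x‖ ≠ s) (v : E) :
    lineDeriv ℝ (fun y : E => max 0 (s - ‖y‖)) x v =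
      (ball (0 : E) s).indicator (fun y => -(inner ℝ y v / ‖y‖)) x := by
  have hcont : Tendsto (fun t : ℝ => ‖x + t • v‖) (𝓝 0) (𝓝 ‖x‖) := by
    have : ContinuousAt (fun t : ℝ => ‖x + t • v‖) 0 := by fun_prop
    simpa [ContinuousAt] using this
  have h0 : ‖x + (0 : ℝ) • v‖ = ‖x‖ := by simp
  by_cases h : ‖x‖ < s
  · have hev : (fun t : ℝ => max 0 (s - ‖x + t • v‖)) =ᶠ[𝓝 0] fun t => s - ‖x + t • v‖ := by
      have := hcont.eventually_lt_const h
      filter_upwards [this] with t ht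
      exact max_eq_right (by linarith)
    have hsq : HasDerivAt (fun t : ℝ => ‖x + t • v‖ ^ 2) (2 * inner ℝ x v) 0 := by
      have h1 : HasDerivAt (fun t : ℝ => x + t • v) v 0 := by
        simpa using ((hasDerivAt_id (0 : ℝ)).smul_const v).const_add x
      simpa using h1.norm_sq
    have hd : HasDerivAt (fun t : ℝ => ‖x + t • v‖) (inner ℝ x v / ‖x‖) 0 := by
      have hne : ‖x + (0 : ℝ) • v‖ ^ 2 ≠ 0 := by
        rw [h0]; exact pow_ne_zero _ (norm_ne_zero_iff.2 hx)
      have := hsq.sqrt hne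
      simp only [Real.sqrt_sq (norm_nonneg _), h0] at this
      convert this using 1
      field_simp
    rw [lineDeriv, hev.deriv_eq, (hd.const_sub s).deriv, indicator_of_mem (by simpa using h)]
  · have h' : s < ‖x‖ := lt_of_le_of_ne (not_lt.1 h) (Ne.symm hxs)
    have hev : (fun t : ℝ => max 0 (s - ‖x + t • v‖)) =ᶠ[𝓝 0] fun t => 0 := by
      have := hcont.eventually_const_lt h'
      filter_upwards [this] with t ht
      exact max_eq_left (by linarith)
    rw [lineDeriv, hev.deriv_eq, indicator_of_notMem (by simpa using h)]
    simp

variable {E : Type*} [NormedAddCommGroup E] [InnerProductSpace ℝ E] [FiniteDimensional ℝ E]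
  [MeasurableSpace E] [BorelSpace E] [Nontrivial E] (μ : Measure E) [μ.IsAddHaarMeasure]

/-- Integration in polar coordinates. -/
theorem integral_eq_integral_sphere {h : E → ℝ} (hh : Integrable h μ) :
    ∫ x, h x ∂μ =
      ∫ s in Ioi (0 : ℝ), s ^ (finrank ℝ E - 1) * ∫ u, h (s • (u : E)) ∂μ.toSphere := by
  have key := μ.measurePreserving_homeomorphUnitSphereProd
  let g : sphere (0 : E) 1 × Ioi (0 : ℝ) → ℝ := fun p => h ((p.2 : ℝ) • (p.1 : E))
  have hg : ∀ x : ({(0)}ᶜ : Set E), g (homeomorphUnitSphereProd E x) = h x := by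
    intro x
    have hx : ‖(x : E)‖ ≠ 0 := norm_ne_zero_iff.2 x.2
    simp [g, smul_smul, hx]
  have hint : Integrable g (μ.toSphere.prod (.volumeIoiPow (finrank ℝ E - 1))) := by
    rw [← key.integrable_comp_emb (Homeomorph.measurableEmbedding _)]
    have : g ∘ homeomorphUnitSphereProd E = fun x : ({(0)}ᶜ : Set E) => h x := funext hg
    rw [this]
    have := (integrableOn_iff_comap_subtypeVal (μ := μ) (f := h)
      (measurableSet_singleton (0 : E)).compl).1 hh.integrableOn
    exact this
  calc
    ∫ x, h x ∂μ = ∫ x : ({(0)}ᶜ : Set E), h x ∂(μ.comap (↑)) := by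
      rw [integral_subtype_comap (measurableSet_singleton _).compl fun x ↦ h x,
        restrict_compl_singleton]
    _ = ∫ p, g p ∂μ.toSphere.prod (.volumeIoiPow (finrank ℝ E - 1)) := by
      rw [← key.integral_comp (Homeomorph.measurableEmbedding _)]
      exact integral_congr_ae (.of_forall fun x => (hg x).symm)
    _ = ∫ s : Ioi (0 : ℝ), ∫ u, h ((s : ℝ) • (u : E)) ∂μ.toSphere
          ∂.volumeIoiPow (finrank ℝ E - 1) := integral_prod_symm _ hint
    _ = _ := by
      simp only [Measure.volumeIoiPow, ENNReal.ofReal]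
      rw [integral_withDensity_eq_integral_smul,
        integral_subtype_comap measurableSet_Ioi fun a ↦ Real.toNNReal (a ^ (finrank ℝ E - 1)) •
          ∫ u, h (a • (u : E)) ∂μ.toSphere,
        setIntegral_congr_fun measurableSet_Ioi fun x hx ↦ ?_]
      · simp only [NNReal.smul_def]
        rw [Real.coe_toNNReal _ (pow_nonneg hx.out.le _), smul_eq_mul]
      · exact (measurable_subtype_coe.pow_const _).real_toNNReal

theorem setIntegral_ball_eq_integral_sphere {h : E → ℝ} {s : ℝ} (hs : 0 ≤ s)
    (hh : IntegrableOn h (ball 0 s) μ) :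
    ∫ x in ball 0 s, h x ∂μ =
      ∫ a in (0 : ℝ)..s, a ^ (finrank ℝ E - 1) * ∫ u, h (a • (u : E)) ∂μ.toSphere := by
  rw [← integral_indicator measurableSet_ball,
    integral_eq_integral_sphere μ (hh.integrable_indicator measurableSet_ball),
    intervalIntegral.integral_of_le hs, integral_Ioc_eq_integral_Ioo,
    ← integral_indicator measurableSet_Ioi, ← integral_indicator measurableSet_Ioo]
  congr 1
  ext a
  by_cases ha : 0 < a
  · by_cases has : a < s
    · have : ∀ u : sphere (0 : E) 1, a • (u : E) ∈ ball (0 : E) s := fun u => by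
        simp [norm_smul, abs_of_pos ha, has]
      simp [ha, has, this, indicator]
    · have : ∀ u : sphere (0 : E) 1, a • (u : E) ∉ ball (0 : E) s := fun u => by
        simpa [norm_smul, abs_of_pos ha] using has
      simp [ha, has, this, indicator]
  · simp [ha, indicator]

/-- The cone is Lipschitz with compact support, so integration by parts moves the derivative onto
it. The points where `lineDeriv_cone` fails, the origin and a sphere, are null. -/
theorem integral_lineDeriv_mul_cone {C : ℝ≥0} {f : E → ℝ} (hf : LipschitzWith C f) (v : E)
    (s : ℝ) :
    ∫ x, lineDeriv ℝ f x v * max 0 (s - ‖x‖) ∂μ =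
      ∫ x in ball 0 s, inner ℝ x v / ‖x‖ * f x ∂μ := by
  have hlip : LipschitzWith 1 (fun y : E => max 0 (s - ‖y‖)) := by
    have h1 : LipschitzWith 1 (fun y : E => s - ‖y‖) := by
      refine LipschitzWith.of_dist_le_mul fun x y => ?_
      have := abs_norm_sub_norm_le y x
      rw [Real.dist_eq, dist_eq_norm, NNReal.coe_one, one_mul, norm_sub_rev]
      convert this using 2
      ring
    exact h1.const_max 0
  have hsupp : HasCompactSupport (fun y : E => max 0 (s - ‖y‖)) := by
    refine HasCompactSupport.of_support_subset_isCompact (isCompact_closedBall (0 : E) s) ?_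
    intro x hx
    rw [mem_closedBall_zero_iff]
    by_contra hlt
    exact hx (max_eq_left (by linarith))
  rw [hf.integral_lineDeriv_mul_eq hlip hsupp, ← integral_indicator measurableSet_ball]
  refine integral_congr_ae ?_
  have h0 : ∀ᵐ x ∂μ, x ≠ 0 := by
    simpa using (measure_eq_zero_iff_ae_notMem.1 (measure_singleton (μ := μ) (0 : E)))
  have h1 : ∀ᵐ x ∂μ, x ∉ sphere (0 : E) s :=
    measure_eq_zero_iff_ae_notMem.1 (Measure.addHaar_sphere μ 0 s)
  filter_upwards [h0, h1] with x hx hxs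
  rw [lineDeriv_cone hx (by simpa using hxs)]
  by_cases hm : x ∈ ball (0 : E) s
  · rw [indicator_of_mem hm, indicator_of_mem hm, inner_neg_right]; ring
  · rw [indicator_of_notMem hm, indicator_of_notMem hm, zero_mul]

/-- The divergence theorem on the unit ball for Lipschitz functions. -/
theorem setIntegral_ball_lineDeriv {C : ℝ≥0} {f : E → ℝ} (hf : LipschitzWith C f) (v : E) :
    ∫ x in ball 0 1, lineDeriv ℝ f x v ∂μ =
      ∫ u, f (u : E) * inner ℝ (u : E) v ∂μ.toSphere := by
  have hfc : Continuous f := hf.continuous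
  have hmeas : Measurable fun x => lineDeriv ℝ f x v := measurable_lineDeriv hfc
  have hsub : ∀ {s : ℝ} {x : E}, x ∉ ball (0 : E) s → max 0 (s - ‖x‖) = 0 := by
    intro s x hx
    exact max_eq_left (by simpa using hx)
  -- The cone identity is differentiated in s at s = 1. The s-derivative of the cone is almost
  -- everywhere the indicator of the ball, which yields the left side; s in (0, 2) keeps the
  -- dominating function supported in the ball of radius 2.
  have hL := (hasDerivAt_integral_of_dominated_loc_of_lip (μ := μ) (𝕜 := ℝ) (x₀ := (1 : ℝ))
    (F := fun (s : ℝ) (x : E) => lineDeriv ℝ f x v * max 0 (s - ‖x‖))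
    (F' := (ball (0 : E) 1).indicator fun x => lineDeriv ℝ f x v)
    (s := Ioo 0 2) (bound := (ball (0 : E) 2).indicator fun _ => (C : ℝ) * ‖v‖)
    (Ioo_mem_nhds (by norm_num) (by norm_num)) ?_ ?_ ?_ ?_ ?_ ?_).2
  -- In polar coordinates the other side is a radial integral with upper limit s, whose derivative
  -- at 1 is the integral over the unit sphere.
  · have hR : HasDerivAt (fun s : ℝ => ∫ a in (0 : ℝ)..s, a ^ (finrank ℝ E - 1) *
        ∫ u, inner ℝ (u : E) v * f (a • (u : E)) ∂μ.toSphere)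
        ((1 : ℝ) ^ (finrank ℝ E - 1) *
          ∫ u, inner ℝ (u : E) v * f ((1 : ℝ) • (u : E)) ∂μ.toSphere) 1 := by
      have hc : Continuous fun a : ℝ => a ^ (finrank ℝ E - 1) *
          ∫ u, inner ℝ (u : E) v * f (a • (u : E)) ∂μ.toSphere := by
        refine (continuous_pow _).mul ?_
        refine continuous_parametric_integral_of_continuous (μ := μ.toSphere) (s := univ)
          (f := fun (a : ℝ) (u : sphere (0 : E) 1) => inner ℝ (u : E) v * f (a • (u : E)))
          ?_ isCompact_univ |>.congr ?_
        · exact by fun_prop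
        · intro a; simp
      exact intervalIntegral.integral_hasDerivAt_right (hc.intervalIntegrable _ _)
        (hc.stronglyMeasurableAtFilter _ _) hc.continuousAt
    have heq : (fun s : ℝ => ∫ x, lineDeriv ℝ f x v * max 0 (s - ‖x‖) ∂μ) =ᶠ[𝓝 1]
        fun s : ℝ => ∫ a in (0 : ℝ)..s, a ^ (finrank ℝ E - 1) *
          ∫ u, inner ℝ (u : E) v * f (a • (u : E)) ∂μ.toSphere := by
      filter_upwards [Ioi_mem_nhds (zero_lt_one (α := ℝ))] with s hs
      have hs : 0 < s := hs
      rw [integral_lineDeriv_mul_cone μ hf v s, setIntegral_ball_eq_integral_sphere μ hs.le]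
      · refine intervalIntegral.integral_congr_ae ?_
        refine .of_forall fun a ha => ?_
        rw [uIoc_of_le hs.le] at ha
        congr 1
        refine integral_congr_ae (.of_forall fun u => ?_)
        have ha' : a ≠ 0 := ha.1.ne'
        simp [norm_smul, abs_of_pos ha.1, inner_smul_left, mul_div_cancel_left₀, ha']
      · obtain ⟨B, hB⟩ := (isCompact_closedBall (0 : E) s).exists_bound_of_continuousOn
          hfc.continuousOn
        refine Measure.integrableOn_of_bounded (M := ‖v‖ * B) measure_ball_lt_top.ne ?_ ?_
        · exact Measurable.aestronglyMeasurable (by fun_prop)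
        · refine (ae_restrict_iff' measurableSet_ball).2 (.of_forall fun x hx => ?_)
          have h1 := hB x (ball_subset_closedBall hx)
          rw [norm_mul, norm_div, norm_norm]
          refine mul_le_mul ?_ h1 (norm_nonneg _) (norm_nonneg _)
          refine div_le_of_le_mul₀ (norm_nonneg _) (norm_nonneg _) ?_
          rw [mul_comm]
          exact norm_inner_le_norm x v
    have := (hL.congr_of_eventuallyEq heq.symm).unique hR
    rw [integral_indicator measurableSet_ball] at this
    rw [this, one_pow, one_mul]
    simp [mul_comm]
  · exact .of_forall fun s => (hmeas.mul (by fun_prop)).aestronglyMeasurable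
  · have : (fun x : E => lineDeriv ℝ f x v * max 0 (1 - ‖x‖)) =
        (ball (0 : E) 1).indicator fun x => lineDeriv ℝ f x v * max 0 (1 - ‖x‖) := by
      ext x
      by_cases hx : x ∈ ball (0 : E) 1
      · rw [indicator_of_mem hx]
      · rw [indicator_of_notMem hx, hsub hx, mul_zero]
    rw [this]
    refine IntegrableOn.integrable_indicator ?_ measurableSet_ball
    refine Measure.integrableOn_of_bounded (M := C * ‖v‖ * 1) measure_ball_lt_top.ne
      (hmeas.mul (by fun_prop)).aestronglyMeasurable (.of_forall fun x => ?_)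
    rw [norm_mul]
    refine mul_le_mul (norm_lineDeriv_le_of_lipschitz ℝ hf) ?_ (norm_nonneg _) (by positivity)
    rw [Real.norm_eq_abs, abs_of_nonneg (le_max_left _ _)]
    exact max_le zero_le_one (by linarith [norm_nonneg x])
  · exact (hmeas.indicator measurableSet_ball).aestronglyMeasurable
  · refine .of_forall fun x => LipschitzOnWith.of_dist_le_mul fun a ha b hb => ?_
    by_cases hx : x ∈ ball (0 : E) 2
    · rw [indicator_of_mem hx, Real.coe_nnabs, abs_of_nonneg (by positivity), Real.dist_eq,
        Real.dist_eq, ← mul_sub, abs_mul]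
      refine mul_le_mul (norm_lineDeriv_le_of_lipschitz ℝ hf) ?_ (abs_nonneg _) (by positivity)
      rw [max_comm 0, max_comm 0]
      simpa using abs_max_sub_max_le_abs (a - ‖x‖) (b - ‖x‖) 0
    · have h2 : 2 ≤ ‖x‖ := by simpa using hx
      have hz : ∀ c ∈ Ioo (0 : ℝ) 2, max 0 (c - ‖x‖) = 0 := fun c hc =>
        max_eq_left (by linarith [hc.2])
      simp [hz a ha, hz b hb, hx]
  · exact (integrable_indicator_iff measurableSet_ball).2
      (integrableOn_const measure_ball_lt_top.ne)
  · have h1 : ∀ᵐ x ∂μ, x ∉ sphere (0 : E) 1 :=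
      measure_eq_zero_iff_ae_notMem.1 (Measure.addHaar_sphere μ 0 1)
    filter_upwards [h1] with x hx
    have hx : ‖x‖ ≠ 1 := by simpa using hx
    by_cases hm : ‖x‖ < 1
    · rw [indicator_of_mem (by simpa using hm)]
      have hev : (fun s : ℝ => lineDeriv ℝ f x v * max 0 (s - ‖x‖)) =ᶠ[𝓝 1]
          fun s => lineDeriv ℝ f x v * (s - ‖x‖) := by
        filter_upwards [Ioi_mem_nhds hm] with s hs
        rw [max_eq_right (by linarith [mem_Ioi.1 hs])]
      refine HasDerivAt.congr_of_eventuallyEq ?_ hev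
      simpa using ((hasDerivAt_id (1 : ℝ)).sub_const ‖x‖).const_mul (lineDeriv ℝ f x v)
    · have h' : 1 < ‖x‖ := lt_of_le_of_ne (not_lt.1 hm) (Ne.symm hx)
      rw [indicator_of_notMem (by simpa using hm)]
      have hev : (fun s : ℝ => lineDeriv ℝ f x v * max 0 (s - ‖x‖)) =ᶠ[𝓝 1] fun s => 0 := by
        filter_upwards [Iio_mem_nhds h'] with s hs
        rw [max_eq_left (by linarith [mem_Iio.1 hs]), mul_zero]
      exact (hasDerivAt_const _ _).congr_of_eventuallyEq hev

end Divergence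

/-! ### DR-submodular functions along the curve z ↦ h_z(x). -/

section Linearization

variable {d : ℕ}

theorem convex_unitCube (d : ℕ) : Convex ℝ (unitCube d) := by
  intro x hx y hy a b ha hb hab i
  have h1 := hx i
  have h2 := hy i
  simp only [PiLp.add_apply, PiLp.smul_apply, smul_eq_mul]
  constructor
  · nlinarith
  · nlinarith

/-- A non-negative DR-submodular function on the cube, with gradient `G`. -/
structure HasDRGradient (F : Vec d → ℝ) (G : Vec d → Vec d) : Prop where
  nonneg : ∀ x ∈ unitCube d, 0 ≤ F x
  grad : ∀ x ∈ unitCube d, HasGradientWithinAt F (G x) (unitCube d) x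
  anti : ∀ x ∈ unitCube d, ∀ y ∈ unitCube d, (∀ i, x i ≤ y i) → ∀ i, G y i ≤ G x i

theorem HasDRGradient.hasDerivWithinAt_comp {F : Vec d → ℝ} {G : Vec d → Vec d}
    (h : HasDRGradient F G) {γ : ℝ → Vec d} {γ' : Vec d} {s : Set ℝ} {t : ℝ} (ht : t ∈ s)
    (hγ : HasDerivWithinAt γ γ' s t) (hs : ∀ a ∈ s, γ a ∈ unitCube d) :
    HasDerivWithinAt (fun a => F (γ a)) (inner ℝ (G (γ t)) γ') s t := by
  have := (h.grad (γ t) (hs t ht)).hasFDerivWithinAt.comp_hasDerivWithinAt t hγ hs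
  rw [InnerProductSpace.toDual_apply_apply] at this
  exact this

theorem inner_le_inner_of_le {a b v : Vec d} (hab : ∀ i, a i ≤ b i) (hv : ∀ i, 0 ≤ v i) :
    inner ℝ a v ≤ inner ℝ b v := by
  simp only [PiLp.inner_apply]
  refine Finset.sum_le_sum fun i _ => ?_
  simp only [RCLike.inner_apply, conj_trivial]
  exact mul_le_mul_of_nonneg_left (hab i) (hv i)

/-- Along a non-negative direction the directional derivative is antitone, so the mean value theorem
brackets the increment by its end values. -/
theorem HasDRGradient.sub_mem_Icc {F : Vec d → ℝ} {G : Vec d → Vec d} (h : HasDRGradient F G)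
    {x v : Vec d} (hx : x ∈ unitCube d) (hxv : x + v ∈ unitCube d) (hv : ∀ i, 0 ≤ v i) :
    inner ℝ (G (x + v)) v ≤ F (x + v) - F x ∧ F (x + v) - F x ≤ inner ℝ (G x) v := by
  have hmem : ∀ a ∈ Set.Icc (0 : ℝ) 1, x + a • v ∈ unitCube d := by
    intro a ha
    have := (convex_unitCube d) hx hxv (sub_nonneg.2 ha.2) ha.1 (by ring)
    convert this using 1
    module
  have hd : ∀ t ∈ Set.Icc (0 : ℝ) 1, HasDerivWithinAt (fun a : ℝ => F (x + a • v))
      (inner ℝ (G (x + t • v)) v) (Set.Icc 0 1) t := by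
    intro t ht
    refine h.hasDerivWithinAt_comp (γ := fun a : ℝ => x + a • v) ht ?_ hmem
    simpa using (((hasDerivAt_id t).smul_const v).const_add x).hasDerivWithinAt
  obtain ⟨t, ht, hmv⟩ := exists_hasDerivAt_eq_slope (fun a : ℝ => F (x + a • v))
    (fun t => inner ℝ (G (x + t • v)) v) zero_lt_one
    (fun t ht => (hd t ht).continuousWithinAt)
    (fun t ht => (hd t ⟨ht.1.le, ht.2.le⟩).hasDerivAt (Icc_mem_nhds ht.1 ht.2))
  have ht' : t ∈ Set.Icc (0 : ℝ) 1 := ⟨ht.1.le, ht.2.le⟩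
  simp only [one_smul, zero_smul, add_zero, sub_zero, div_one] at hmv
  rw [← hmv]
  constructor
  · refine inner_le_inner_of_le (h.anti _ (hmem t ht') _ hxv fun i => ?_) hv
    have := mul_le_mul_of_nonneg_right ht'.2 (hv i)
    simpa using this
  · refine inner_le_inner_of_le (h.anti _ hx _ (hmem t ht') fun i => ?_) hv
    have := mul_nonneg ht'.1 (hv i)
    simpa using this

/-- Concavity along non-negative directions and non-negativity. -/
theorem HasDRGradient.mul_le {F : Vec d → ℝ} {G : Vec d → Vec d} (h : HasDRGradient F G)
    {x v : Vec d} {θ : ℝ} (hθ : θ ∈ Set.Icc (0 : ℝ) 1) (hx : x ∈ unitCube d)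
    (hxv : x + v ∈ unitCube d) (hv : ∀ i, 0 ≤ v i) :
    (1 - θ) * F x ≤ F (x + θ • v) := by
  have hp : x + θ • v ∈ unitCube d := by
    have := (convex_unitCube d) hx hxv (sub_nonneg.2 hθ.2) hθ.1 (by ring)
    convert this using 1
    module
  have h1 := (h.sub_mem_Icc (v := θ • v) hx hp
    (fun i => by simpa using mul_nonneg hθ.1 (hv i))).1
  have he : x + θ • v + (1 - θ) • v = x + v := by module
  have h2 := (h.sub_mem_Icc (x := x + θ • v) (v := (1 - θ) • v) hp (by rwa [he])
    (fun i => by simpa using mul_nonneg (sub_nonneg.2 hθ.2) (hv i))).2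
  rw [he] at h2
  rw [inner_smul_right] at h1 h2
  have h3 := h.nonneg _ hxv
  have h4 : (1 - θ) * (θ * inner ℝ (G (x + θ • v)) v) ≤
      (1 - θ) * (F (x + θ • v) - F x) := mul_le_mul_of_nonneg_left h1 (sub_nonneg.2 hθ.2)
  have h5 := mul_le_mul_of_nonneg_left h2 hθ.1
  have h6 := mul_nonneg hθ.1 h3
  nlinarith

theorem hMap_mem_unitCube {z : ℝ} (hz : 0 ≤ z) {x : Vec d} (hx : x ∈ unitCube d) :
    hMap z x ∈ unitCube d := by
  intro i
  have h1 : 0 ≤ z * x i := mul_nonneg hz (hx i).1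
  have h2 : Real.exp (-(z * x i)) ≤ 1 := Real.exp_le_one_iff.2 (by linarith)
  have h3 := Real.exp_pos (-(z * x i))
  simp only [hMap]
  constructor <;> linarith

theorem hMap_le {z : ℝ} (hz : z ∈ Set.Icc (0 : ℝ) 1) {x : Vec d} {i : Fin d} (hx : 0 ≤ x i) :
    hMap z x i ≤ x i := by
  have h2 := Real.add_one_le_exp (-(z * x i))
  have h3 : z * x i ≤ x i := mul_le_of_le_one_left hx hz.2
  simp only [hMap]
  linarith

@[simp] theorem hMap_apply (z : ℝ) (x : Vec d) (i : Fin d) :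
    hMap z x i = 1 - Real.exp (-(z * x i)) := rfl

@[simp] theorem expScale_apply (z : ℝ) (x g : Vec d) (i : Fin d) :
    expScale z x g i = g i * Real.exp (-(z * x i)) := rfl

theorem hasDerivAt_hMap (x : Vec d) (z : ℝ) :
    HasDerivAt (fun z => hMap z x) (expScale z x x) z := by
  rw [hasDerivAt_iff_hasFDerivAt, ← hasFDerivWithinAt_univ, hasFDerivWithinAt_euclidean]
  intro i
  rw [hasFDerivWithinAt_univ]
  have h1 : HasDerivAt (fun z : ℝ => -(z * x i)) (-(x i)) z := by
    simpa using! ((hasDerivAt_id z).mul_const (x i)).neg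
  have := (h1.exp).const_sub 1
  have h2 : PiLp.proj 2 (fun _ : Fin d => ℝ) i ∘SL
      ContinuousLinearMap.toSpanSingleton ℝ (expScale z x x) =
      ContinuousLinearMap.toSpanSingleton ℝ (-(Real.exp (-(z * x i)) * -x i)) := by
    ext
    simp [mul_comm]
  rw [h2]
  exact this.hasFDerivAt

theorem expScale_sub (z : ℝ) (x g g' : Vec d) :
    expScale z x (g - g') = expScale z x g - expScale z x g' := by
  ext i; simp [sub_mul]

theorem expScale_smul (z a : ℝ) (x g : Vec d) :
    expScale z x (a • g) = a • expScale z x g := by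
  ext i; simp [mul_assoc]

/-- The point equals y + h_z(x) ⊙ (1 - y), and h_z(x) ≤ θ = 1 - e^{-z} coordinatewise. Hence it lies
at fraction θ of a segment that leaves y in a non-negative direction and ends inside the cube, and
`HasDRGradient.mul_le` applies. -/
theorem HasDRGradient.le_apply_add_expScale {F : Vec d → ℝ} {G : Vec d → Vec d}
    (h : HasDRGradient F G) {x y : Vec d} (hx : x ∈ unitCube d) (hy : y ∈ unitCube d)
    {z : ℝ} (hz : z ∈ Set.Icc (0 : ℝ) 1) :
    Real.exp (-z) * F y ≤ F (hMap z x + expScale z x y) := by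
  -- For z = 0 the fraction θ vanishes and the direction v below could not be normalized by it.
  rcases hz.1.eq_or_lt with rfl | hz0
  · have : hMap 0 x + expScale 0 x y = y := by ext i; simp
    rw [this]; simp
  have he1 : Real.exp (-z) < 1 := by
    rw [← Real.exp_zero]; exact Real.exp_lt_exp.2 (by linarith)
  set θ := 1 - Real.exp (-z) with hθ
  have hθ0 : 0 < θ := by linarith
  have hw : ∀ i, 0 ≤ hMap z x i ∧ hMap z x i ≤ θ := by
    intro i
    refine ⟨(hMap_mem_unitCube hz.1 hx i).1, ?_⟩
    have : Real.exp (-z) ≤ Real.exp (-(z * x i)) :=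
      Real.exp_le_exp.2 (by nlinarith [(hx i).2])
    simp only [hMap_apply, hθ]
    linarith
  let v : Vec d := WithLp.toLp 2 fun i => θ⁻¹ * (hMap z x i * (1 - y i))
  have hv : ∀ i, 0 ≤ v i ∧ v i ≤ 1 - y i := by
    intro i
    have h1 : 0 ≤ 1 - y i := sub_nonneg.2 (hy i).2
    refine ⟨mul_nonneg (inv_nonneg.2 hθ0.le) (mul_nonneg (hw i).1 h1), ?_⟩
    change θ⁻¹ * (hMap z x i * (1 - y i)) ≤ 1 - y i
    rw [inv_mul_le_iff₀ hθ0]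
    exact mul_le_mul_of_nonneg_right (hw i).2 h1
  have := h.mul_le (x := y) (v := v) (θ := θ)
    ⟨hθ0.le, by linarith [Real.exp_pos (-z)]⟩ hy
    (fun i => ⟨add_nonneg (hy i).1 (hv i).1, by
      have := (hv i).2
      simp only [PiLp.add_apply]; linarith⟩) (fun i => (hv i).1)
  have heq : y + θ • v = hMap z x + expScale z x y := by
    ext i
    simp only [v, PiLp.add_apply, PiLp.smul_apply, smul_eq_mul, mul_inv_cancel_left₀ hθ0.ne',
      hMap_apply, expScale_apply]
    ring
  rw [heq] at this
  simpa [hθ] using this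

/-- The gradient need not be continuous. The one-sided form of the fundamental theorem is used,
which asks for integrability of the minorant of the derivative only. -/
theorem HasDRGradient.exp_neg_one_mul_sub_le {F : Vec d → ℝ} {G : Vec d → Vec d}
    (h : HasDRGradient F G) {x y : Vec d} (hx : x ∈ unitCube d) (hy : y ∈ unitCube d)
    (hint : IntegrableOn (fun z => Real.exp (z - 1) *
      inner ℝ (G (hMap z x)) (expScale z x (y - x))) (Set.Icc 0 1)) :
    Real.exp (-1) * F y - F (hMap 1 x) ≤
      ∫ z in (0 : ℝ)..1, Real.exp (z - 1) * inner ℝ (G (hMap z x)) (expScale z x (y - x)) := by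
  set Φ := fun z => Real.exp (z - 1) * inner ℝ (G (hMap z x)) (expScale z x (y - x))
  have hd : ∀ z ∈ Set.Icc (0 : ℝ) 1, HasDerivWithinAt
      (fun z => Real.exp (z - 1) * F (hMap z x))
      (Real.exp (z - 1) * F (hMap z x) +
        Real.exp (z - 1) * inner ℝ (G (hMap z x)) (expScale z x x)) (Set.Icc 0 1) z := by
    intro z hz
    have h1 : HasDerivAt (fun z : ℝ => Real.exp (z - 1)) (Real.exp (z - 1)) z := by
      simpa using ((hasDerivAt_id z).sub_const 1).exp
    exact h1.hasDerivWithinAt.mul (h.hasDerivWithinAt_comp hz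
      (hasDerivAt_hMap x z).hasDerivWithinAt fun a ha => hMap_mem_unitCube ha.1 hx)
  have key := intervalIntegral.integral_le_sub_of_hasDeriv_right_of_le
    (φ := fun z => Real.exp (-1) * F y - Φ z) zero_le_one
    (fun z hz => (hd z hz).continuousWithinAt)
    (fun z hz => ((hd z ⟨hz.1.le, hz.2.le⟩).hasDerivAt
      (Icc_mem_nhds hz.1 hz.2)).hasDerivWithinAt)
    ((integrableOn_const (by simp)).sub hint) ?_
  · rw [intervalIntegral.integral_sub (by simp) ((intervalIntegrable_iff_integrableOn_Icc_of_le
      zero_le_one).2 hint)] at key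
    simp only [intervalIntegral.integral_const, sub_zero, one_smul, sub_self, Real.exp_zero,
      one_mul, zero_sub] at key
    -- The boundary term at z = 0 is dropped by non-negativity.
    have := mul_nonneg (Real.exp_pos (-1)).le (h.nonneg _ (hMap_mem_unitCube le_rfl hx))
    linarith
  · intro z hz
    have hz' : z ∈ Set.Icc (0 : ℝ) 1 := ⟨hz.1.le, hz.2.le⟩
    have h1 := h.le_apply_add_expScale hx hy hz'
    have hm := hMap_mem_unitCube hz.1.le hx
    have h2 := (h.sub_mem_Icc (x := hMap z x) (v := expScale z x y) hm
      (fun i => by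
        have h3 := hy i
        have h4 := Real.exp_pos (-(z * x i))
        have h5 := (hm i).1
        simp only [hMap_apply] at h5
        simp only [PiLp.add_apply, hMap_apply, expScale_apply]
        constructor <;> nlinarith)
      (fun i => mul_nonneg (hy i).1 (Real.exp_pos _).le)).2
    have h3 : Real.exp (-1) * F y = Real.exp (z - 1) * (Real.exp (-z) * F y) := by
      rw [← mul_assoc, ← Real.exp_add]; ring_nf
    have h4 := mul_le_mul_of_nonneg_left (h1.trans (sub_le_iff_le_add.1 h2))
      (Real.exp_pos (z - 1)).le
    simp only [Φ, expScale_sub, inner_sub_right]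
    rw [h3]
    linarith

/-- Precomposition with a homothety that maps the cube into itself. -/
theorem HasDRGradient.comp_homothety {F : Vec d → ℝ} {G : Vec d → Vec d}
    (h : HasDRGradient F G) {a : ℝ} (ha : a ∈ Set.Icc (0 : ℝ) 1) {b : Vec d}
    (hb : b ∈ unitCube d) :
    HasDRGradient (fun x => F (a • x + (1 - a) • b)) (fun x => a • G (a • x + (1 - a) • b)) := by
  have hmem : ∀ x ∈ unitCube d, a • x + (1 - a) • b ∈ unitCube d := fun x hx =>
    convex_unitCube d hx hb ha.1 (sub_nonneg.2 ha.2) (by ring)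
  refine ⟨fun x hx => h.nonneg _ (hmem x hx), fun x hx => ?_, fun x hx y hy hxy i => ?_⟩
  · have h1 := (h.grad _ (hmem x hx)).hasFDerivWithinAt
    have h2 : HasFDerivWithinAt (fun x : Vec d => a • x + (1 - a) • b)
        (a • ContinuousLinearMap.id ℝ (Vec d)) (unitCube d) x :=
      (((hasFDerivAt_id x).const_smul a).add_const _).hasFDerivWithinAt
    rw [hasGradientWithinAt_iff_hasFDerivWithinAt]
    have h3 := h1.comp x h2 hmem
    have h4 : InnerProductSpace.toDual ℝ (Vec d) (G (a • x + (1 - a) • b)) ∘SL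
        (a • ContinuousLinearMap.id ℝ (Vec d)) =
        InnerProductSpace.toDual ℝ (Vec d) (a • G (a • x + (1 - a) • b)) := by
      ext w
      simp
    rw [h4] at h3
    exact h3
  · have := h.anti _ (hmem x hx) _ (hmem y hy) (fun i => by
      simpa using mul_le_mul_of_nonneg_left (hxy i) ha.1) i
    simpa using mul_le_mul_of_nonneg_left this ha.1

end Linearization

/-! ### The infeasible projection. -/

section InfeasibleProjection

variable {d : ℕ}

/-- Points of `D` whose `ε`-neighbourhood relative to the affine hull lies in `D`. -/
def IsDeep (D : Set (Vec d)) (ε : ℝ) (y : Vec d) : Prop :=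
  y ∈ D ∧ ∀ w ∈ vectorSpan ℝ D, ‖w‖ ≤ ε → y + w ∈ D

theorem sub_mem_vectorSpan {D : Set (Vec d)} {x y : Vec d} (hx : x ∈ D) (hy : y ∈ D) :
    x - y ∈ vectorSpan ℝ D := by
  simpa using vsub_mem_vectorSpan ℝ hx hy

theorem inner_starProjection_eq (L : Submodule ℝ (Vec d)) {g w : Vec d} (hw : w ∈ L) :
    inner ℝ (L.starProjection g) w = inner ℝ g w := by
  rw [Submodule.inner_starProjection_left_eq_right, Submodule.starProjection_eq_self_iff.2 hw]

theorem soipStep_sub_mem {D : Set (Vec d)} {c y : Vec d} (so : Vec d → Vec d) (ε : ℝ)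
    (hy : y - c ∈ vectorSpan ℝ D) : soipStep D so ε y - c ∈ vectorSpan ℝ D := by
  have : soipStep D so ε y - c = (y - c) -
      (ε / ‖(vectorSpan ℝ D).starProjection (so y)‖) •
        (vectorSpan ℝ D).starProjection (so y) := by
    rw [soipStep]; abel
  rw [this]
  exact Submodule.sub_mem _ hy (Submodule.smul_mem _ _ (Submodule.starProjection_apply_mem _ _))

/-- Depth puts q + ε g/‖g‖ in D, so separating y from that point gives ⟨g, y - q⟩ > ε ‖g‖. Expanding
the square after a step of length ε then gains 2ε² - ε². -/
theorem norm_soipStep_sub_sq_le {D : Set (Vec d)} {c y q : Vec d} {so : Vec d → Vec d} {ε : ℝ}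
    (hso : IsSeparationOracle D so) (hε : 0 ≤ ε) (hc : c ∈ D) (hq : IsDeep D ε q)
    (hyc : y - c ∈ vectorSpan ℝ D) (hy : y ∉ D) :
    ‖soipStep D so ε y - q‖ ^ 2 ≤ ‖y - q‖ ^ 2 - ε ^ 2 := by
  set L := vectorSpan ℝ D
  set g := L.starProjection (so y) with hg
  have hgL : g ∈ L := Submodule.starProjection_apply_mem _ _
  have hyD : ∀ x ∈ D, y - x ∈ L := fun x hx => by
    have := Submodule.add_mem _ hyc (sub_mem_vectorSpan hc hx)
    simpa using this
  have hsep : ∀ x ∈ D, 0 < inner ℝ g (y - x) := fun x hx => by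
    rw [hg, inner_starProjection_eq L (hyD x hx)]
    exact hso.2 y hy x hx
  have hg0 : 0 < ‖g‖ := by
    rw [norm_pos_iff]
    intro h0
    have := hsep c hc
    rw [h0, inner_zero_left] at this
    exact lt_irrefl _ this
  have hstep : soipStep D so ε y - q = (y - q) - (ε / ‖g‖) • g := by
    rw [soipStep]; abel
  have hmem : q + (ε / ‖g‖) • g ∈ D := by
    refine hq.2 _ (Submodule.smul_mem _ _ hgL) ?_
    rw [norm_smul, Real.norm_of_nonneg (by positivity), div_mul_cancel₀ _ hg0.ne']
  have h1 := hsep _ hmem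
  rw [← sub_sub, inner_sub_right, inner_smul_right, real_inner_self_eq_norm_sq] at h1
  have h2 : ε * ‖g‖ ≤ inner ℝ g (y - q) := by
    have : ε / ‖g‖ * ‖g‖ ^ 2 = ε * ‖g‖ := by field_simp
    linarith
  have h3 : ε * ε ≤ ε / ‖g‖ * inner ℝ g (y - q) := by
    have := mul_le_mul_of_nonneg_left h2 (div_nonneg hε hg0.le)
    have h4 : ε / ‖g‖ * (ε * ‖g‖) = ε * ε := by field_simp
    linarith
  rw [hstep, norm_sub_sq_real, inner_smul_right, real_inner_comm, norm_smul,
    Real.norm_of_nonneg (by positivity), div_mul_cancel₀ _ hg0.ne']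
  linarith

/-- The rescaled vector is the metric projection of w on the ball of radius R. -/
theorem norm_ballProjection_sub_le {w q : Vec d} {R : ℝ} (hR : 0 < R) (hq : ‖q‖ ≤ R) :
    ‖(max 1 (‖w‖ / R))⁻¹ • w - q‖ ≤ ‖w - q‖ := by
  rcases le_total (‖w‖ / R) 1 with h | h
  · rw [max_eq_left h]; simp
  · rw [max_eq_right h, inv_div]
    have hw : R ≤ ‖w‖ := (one_le_div hR).1 h
    have hw0 : 0 < ‖w‖ := hR.trans_le hw
    set s := R / ‖w‖ with hs
    have hs0 : 0 ≤ s := by positivity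
    have hs1 : s ≤ 1 := (div_le_one hw0).2 hw
    have hsw : s * ‖w‖ = R := div_mul_cancel₀ _ hw0.ne'
    rw [← sq_le_sq₀ (norm_nonneg _) (norm_nonneg _), norm_sub_sq_real, norm_sub_sq_real,
      inner_smul_left, norm_smul, Real.norm_of_nonneg hs0, conj_trivial]
    have h1 : inner ℝ w q ≤ ‖w‖ * R :=
      (real_inner_le_norm w q).trans (mul_le_mul_of_nonneg_left hq hw0.le)
    rw [← hsw] at h1
    have h2 := mul_le_mul_of_nonneg_left h1 (sub_nonneg.2 hs1)
    nlinarith [mul_nonneg (sub_nonneg.2 hs1) (mul_nonneg (sub_nonneg.2 hs1) (sq_nonneg ‖w‖))]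

theorem soipStart_sub_mem (D : Set (Vec d)) (c y : Vec d) :
    soipStart D c y - c ∈ vectorSpan ℝ D := by
  simp only [soipStart, add_sub_cancel_left]
  exact Submodule.smul_mem _ _ (Submodule.starProjection_apply_mem _ _)

theorem norm_soipStart_sub_le {D : Set (Vec d)} {c y q : Vec d} (hD : Bornology.IsBounded D)
    (hDn : D.Nontrivial) (hc : c ∈ D) (hq : q ∈ D) :
    ‖soipStart D c y - q‖ ≤ ‖y - q‖ := by
  set L := vectorSpan ℝ D
  have hR : 0 < Metric.diam D := Metric.diam_pos hDn hD
  have hqR : ‖q - c‖ ≤ Metric.diam D := by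
    rw [← dist_eq_norm]; exact Metric.dist_le_diam_of_mem hD hq hc
  have h1 := norm_ballProjection_sub_le (w := L.starProjection (y - c)) hR hqR
  have h2 : ‖L.starProjection (y - c) - (q - c)‖ ≤ ‖y - q‖ := by
    have h3 : L.starProjection (q - c) = q - c :=
      Submodule.starProjection_eq_self_iff.2 (sub_mem_vectorSpan hq hc)
    have h4 : L.starProjection (y - c) - (q - c) = L.starProjection (y - q) := by
      conv_lhs => rw [← h3, ← map_sub]
      congr 1; abel
    rw [h4]
    exact Submodule.norm_starProjection_apply_le L _
  refine le_trans (le_of_eq ?_) (h1.trans h2)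
  simp only [soipStart, add_sub_cancel_left]
  congr 1
  abel

theorem soipStep_iterate {D : Set (Vec d)} {c q : Vec d} {so : Vec d → Vec d} {ε : ℝ}
    (hso : IsSeparationOracle D so) (hε : 0 ≤ ε) (hc : c ∈ D) (hq : IsDeep D ε q)
    {y : Vec d} (hy : y - c ∈ vectorSpan ℝ D) (n : ℕ)
    (hn : ∀ m < n, (soipStep D so ε)^[m] y ∉ D) :
    (soipStep D so ε)^[n] y - c ∈ vectorSpan ℝ D ∧
      ‖(soipStep D so ε)^[n] y - q‖ ^ 2 ≤ ‖y - q‖ ^ 2 - n * ε ^ 2 := by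
  induction n with
  | zero => simpa using hy
  | succ n ih =>
    obtain ⟨h1, h2⟩ := ih fun m hm => hn m (by omega)
    rw [Function.iterate_succ_apply']
    refine ⟨soipStep_sub_mem so ε h1, ?_⟩
    have h3 := norm_soipStep_sub_sq_le hso hε hc hq h1 (hn n (by omega))
    push_cast
    linarith

/-- Each pass outside D removes ε² from the squared distance to q, which cannot become negative. -/
theorem exists_soipStep_iterate_mem {D : Set (Vec d)} {c q : Vec d} {so : Vec d → Vec d} {ε : ℝ}
    (hso : IsSeparationOracle D so) (hε : 0 < ε) (hc : c ∈ D) (hq : IsDeep D ε q)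
    {y : Vec d} (hy : y - c ∈ vectorSpan ℝ D) : ∃ n, (soipStep D so ε)^[n] y ∈ D := by
  by_contra! hcon
  obtain ⟨n, hn⟩ := exists_nat_gt (‖y - q‖ ^ 2 / ε ^ 2)
  have h1 := (soipStep_iterate hso hε.le hc hq hy n fun m _ => hcon m).2
  rw [div_lt_iff₀ (by positivity)] at hn
  linarith [sq_nonneg ‖(soipStep D so ε)^[n] y - q‖]

/-- Termination makes the index set nonempty, so its `sInf` is a genuine hitting time and not the
default value 0. -/
theorem soip_mem {D : Set (Vec d)} {c q : Vec d} {so : Vec d → Vec d} {ε : ℝ}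
    (hso : IsSeparationOracle D so) (hε : 0 < ε) (hc : c ∈ D) (hq : IsDeep D ε q) (y : Vec d) :
    soip D c so ε y ∈ D :=
  Nat.sInf_mem (s := {n | (soipStep D so ε)^[n] (soipStart D c y) ∈ D})
    (exists_soipStep_iterate_mem hso hε hc hq (soipStart_sub_mem D c y))

/-- The infeasible projection does not increase the distance to deep points. -/
theorem norm_soip_sub_le {D : Set (Vec d)} {c q : Vec d} {so : Vec d → Vec d} {ε : ℝ}
    (hD : Bornology.IsBounded D) (hDn : D.Nontrivial)
    (hso : IsSeparationOracle D so) (hε : 0 < ε) (hc : c ∈ D) (hq : IsDeep D ε q) (y : Vec d) :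
    ‖soip D c so ε y - q‖ ≤ ‖y - q‖ := by
  refine le_trans ?_ (norm_soipStart_sub_le hD hDn hc hq.1)
  have h := (soipStep_iterate hso hε.le hc hq (soipStart_sub_mem D c y) _
    fun m hm => Nat.notMem_of_lt_sInf (s := {n | (soipStep D so ε)^[n] (soipStart D c y) ∈ D})
      hm).2
  rw [← sq_le_sq₀ (norm_nonneg _) (norm_nonneg _)]
  refine h.trans ?_
  have := mul_nonneg (Nat.cast_nonneg (α := ℝ)
    (sInf {n | (soipStep D so ε)^[n] (soipStart D c y) ∈ D})) (sq_nonneg ε)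
  linarith

theorem measurable_soipStep (D : Set (Vec d)) {so : Vec d → Vec d} (hso : Measurable so) (ε : ℝ) :
    Measurable (soipStep D so ε) := by
  unfold soipStep
  have : Measurable fun y => (vectorSpan ℝ D).starProjection (so y) :=
    (vectorSpan ℝ D).starProjection.continuous.measurable.comp hso
  fun_prop

theorem measurable_soipStart (D : Set (Vec d)) (c : Vec d) : Measurable (soipStart D c) := by
  unfold soipStart
  have : Measurable fun y : Vec d => (vectorSpan ℝ D).starProjection (y - c) :=
    (vectorSpan ℝ D).starProjection.continuous.measurable.comp (by fun_prop)
  simp only [add_sub_cancel_left]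
  fun_prop

/-- The number of passes is a measurable hitting time with countably many values, and each fixed
iterate is measurable. -/
theorem measurable_soip {D : Set (Vec d)} {c q : Vec d} {so : Vec d → Vec d} {ε : ℝ}
    (hD : MeasurableSet D) (hso : IsSeparationOracle D so) (hε : 0 < ε) (hc : c ∈ D)
    (hq : IsDeep D ε q) : Measurable (soip D c so ε) := by
  classical
  have hit : ∀ n : ℕ, Measurable fun y => (soipStep D so ε)^[n] (soipStart D c y) := fun n =>
    ((measurable_soipStep D hso.1 ε).iterate n).comp (measurable_soipStart D c)
  have hex : ∀ y, ∃ n, (soipStep D so ε)^[n] (soipStart D c y) ∈ D := fun y =>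
    exists_soipStep_iterate_mem hso hε hc hq (soipStart_sub_mem D c y)
  have hN : Measurable fun y =>
      sInf {n : ℕ | (soipStep D so ε)^[n] (soipStart D c y) ∈ D} := by
    have heq : (fun y => sInf {n : ℕ | (soipStep D so ε)^[n] (soipStart D c y) ∈ D}) =
        fun y => Nat.find (hex y) := by
      ext y
      exact Nat.sInf_def (hex y)
    rw [heq]
    exact measurable_find hex fun n => hit n hD
  have hu : Measurable fun p : Vec d × ℕ => (soipStep D so ε)^[p.2] (soipStart D c p.1) :=
    measurable_from_prod_countable_left fun n => hit n
  exact hu.comp (measurable_id.prodMk hN)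

end InfeasibleProjection

/-! ### Standing assumptions and geometry of the shrunk domain. -/

variable {d : ℕ}

/-- The standing assumptions on the input of the algorithm. -/
structure Input.Valid (p : Input d) : Prop where
  r_pos : 0 < p.r
  v_pos : 0 < p.v
  B₀_pos : 0 < p.B₀
  sub_cube : p.K ⊆ unitCube d
  closed : IsClosed p.K
  convex : Convex ℝ p.K
  down : IsDownClosed p.K
  nontrivial : p.K.Nontrivial
  c_mem : p.c ∈ p.K
  ball_sub : Metric.closedBall p.c p.r ∩ (affineSpan ℝ p.K : Set (Vec d)) ⊆ p.K
  T_pos : 1 ≤ p.T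
  δ_lt : p.δ < p.r
  ε_lt : p.ε < p.rDom
  oracle : IsSeparationOracle p.dom p.so

theorem norm_sub_le_sqrt {x y : Vec d} (hx : x ∈ unitCube d) (hy : y ∈ unitCube d) :
    ‖x - y‖ ≤ √d := by
  rw [EuclideanSpace.norm_eq]
  refine Real.sqrt_le_sqrt ?_
  calc ∑ i, ‖(x - y) i‖ ^ 2 ≤ ∑ _i : Fin d, (1 : ℝ) := by
        refine Finset.sum_le_sum fun i _ => ?_
        rw [Real.norm_eq_abs, sq_abs, PiLp.sub_apply, sq_le_one_iff_abs_le_one, abs_le]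
        constructor <;> linarith [(hx i).1, (hx i).2, (hy i).1, (hy i).2]
    _ = d := by simp

theorem norm_expScale_le {z : ℝ} (hz : 0 ≤ z) {x : Vec d} (hx : x ∈ unitCube d) (g : Vec d) :
    ‖expScale z x g‖ ≤ ‖g‖ := by
  rw [EuclideanSpace.norm_eq, EuclideanSpace.norm_eq]
  refine Real.sqrt_le_sqrt (Finset.sum_le_sum fun i _ => ?_)
  rw [expScale_apply, norm_mul]
  refine pow_le_pow_left₀ (by positivity) (mul_le_of_le_one_right (norm_nonneg _) ?_) _
  rw [Real.norm_of_nonneg (Real.exp_pos _).le, Real.exp_le_one_iff]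
  linarith [mul_nonneg hz (hx i).1]

theorem inner_expScale_left (z : ℝ) (x g w : Vec d) :
    inner ℝ (expScale z x g) w = inner ℝ g (expScale z x w) := by
  simp only [PiLp.inner_apply, expScale_apply, RCLike.inner_apply, conj_trivial]
  exact Finset.sum_congr rfl fun i _ => by ring

theorem continuous_expScale : Continuous fun q : ℝ × Vec d × Vec d => expScale q.1 q.2.1 q.2.2 := by
  unfold expScale
  fun_prop

theorem continuous_hMap : Continuous fun q : ℝ × Vec d => hMap q.1 q.2 := by
  unfold hMap
  fun_prop

theorem continuous_shrink (c : Vec d) (r δ : ℝ) : Continuous (shrink c r δ) := by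
  unfold shrink
  fun_prop

theorem continuous_unshrink (c : Vec d) (r δ : ℝ) : Continuous (unshrink c r δ) := by
  unfold unshrink
  fun_prop

theorem shrink_sub_shrink (c : Vec d) (r δ : ℝ) (x y : Vec d) :
    shrink c r δ x - shrink c r δ y = (1 - δ / r) • (x - y) := by
  unfold shrink; module

theorem Input.shrink_mem_dom (p : Input d) {x : Vec d} (hx : x ∈ p.K) : shrink p.c p.r p.δ x ∈ p.dom :=
  Set.mem_image_of_mem _ hx

theorem Input.vectorSpan_dom_le (p : Input d) : vectorSpan ℝ p.dom ≤ p.L₀ := by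
  refine Submodule.span_le.2 ?_
  rintro _ ⟨_, ⟨x, hx, rfl⟩, _, ⟨y, hy, rfl⟩, rfl⟩
  simp only [vsub_eq_sub, shrink_sub_shrink]
  exact Submodule.smul_mem _ _ (sub_mem_vectorSpan hx hy)

namespace Input.Valid

variable {p : Input d} (hp : p.Valid)
include hp

theorem δ_pos : 0 < p.δ := by
  have : (0 : ℝ) < p.T := by exact_mod_cast hp.T_pos
  exact Real.rpow_pos_of_pos this _

theorem ε_pos : 0 < p.ε := by
  have : (0 : ℝ) < p.T := by exact_mod_cast hp.T_pos
  exact mul_pos hp.v_pos (Real.rpow_pos_of_pos this _)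

theorem rDom_pos : 0 < p.rDom := sub_pos.2 hp.δ_lt

theorem one_sub_pos : 0 < 1 - p.δ / p.r := sub_pos.2 ((div_lt_one hp.r_pos).2 hp.δ_lt)

theorem ratio_pos : 0 < p.δ / p.r := div_pos hp.δ_pos hp.r_pos

theorem isCompact : IsCompact p.K := by
  refine Metric.isCompact_of_isClosed_isBounded hp.closed ?_
  rw [Metric.isBounded_iff]
  exact ⟨√d, fun x hx y hy => by
    rw [dist_eq_norm]; exact norm_sub_le_sqrt (hp.sub_cube hx) (hp.sub_cube hy)⟩

theorem add_mem {w : Vec d} (hw : w ∈ p.L₀) (hwr : ‖w‖ ≤ p.r) : p.c + w ∈ p.K := by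
  refine hp.ball_sub ⟨by simpa using hwr, ?_⟩
  have := AffineSubspace.vadd_mem_of_mem_direction (s := affineSpan ℝ p.K) (v := w)
    (by rwa [direction_affineSpan]) (mem_affineSpan ℝ hp.c_mem)
  rwa [vadd_eq_add, add_comm] at this

theorem zero_mem : (0 : Vec d) ∈ p.K :=
  hp.down _ hp.c_mem 0 fun i => ⟨le_rfl, (hp.sub_cube hp.c_mem i).1⟩

theorem mem_L₀ {x : Vec d} (hx : x ∈ p.K) : x ∈ p.L₀ := by
  have := sub_mem_vectorSpan hx hp.zero_mem
  rwa [sub_zero] at this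

/-- If coordinate i vanished on K it would vanish on L₀. Otherwise some x in K has x_i ≠ 0, and
down-closedness puts x_i e_i in K. -/
theorem single_mem_L₀ {w : Vec d} (hw : w ∈ p.L₀) (i : Fin d) (a : ℝ) (hi : w i ≠ 0) :
    EuclideanSpace.single i a ∈ p.L₀ := by
  have hex : ∃ x ∈ p.K, x i ≠ 0 := by
    by_contra! hcon
    have hle : p.L₀ ≤ LinearMap.ker (EuclideanSpace.proj i : Vec d →L[ℝ] ℝ).toLinearMap := by
      refine Submodule.span_le.2 ?_
      rintro _ ⟨x, hx, y, hy, rfl⟩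
      simp [hcon x hx, hcon y hy]
    exact hi (by simpa using hle hw)
  obtain ⟨x, hx, hxi⟩ := hex
  have h1 : EuclideanSpace.single i (x i) ∈ p.K := by
    refine hp.down x hx _ fun j => ?_
    rw [PiLp.single_apply]
    split_ifs with h
    · subst h; exact ⟨(hp.sub_cube hx _).1, le_rfl⟩
    · exact ⟨le_rfl, (hp.sub_cube hx j).1⟩
  have h2 := Submodule.smul_mem _ (a / x i) (hp.mem_L₀ h1)
  convert h2 using 1
  ext j
  simp only [PiLp.single_apply, PiLp.smul_apply, smul_eq_mul]
  split_ifs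
  · field_simp
  · simp

/-- As `K` is down-closed, `L₀` is spanned by coordinate vectors. -/
theorem expScale_mem_L₀ (z : ℝ) (x : Vec d) {w : Vec d} (hw : w ∈ p.L₀) :
    expScale z x w ∈ p.L₀ := by
  have : expScale z x w = ∑ i, EuclideanSpace.single i (expScale z x w i) := by
    ext j
    simp
  rw [this]
  refine Submodule.sum_mem _ fun i _ => ?_
  by_cases hi : w i = 0
  · have h0 : EuclideanSpace.single i (0 : ℝ) = 0 := by ext j; simp
    rw [expScale_apply, hi, zero_mul, h0]
    exact Submodule.zero_mem _
  · exact hp.single_mem_L₀ hw i _ hi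

theorem hMap_mem {x : Vec d} (hx : x ∈ p.K) {z : ℝ} (hz : z ∈ Set.Icc (0 : ℝ) 1) :
    hMap z x ∈ p.K :=
  hp.down x hx _ fun i => ⟨(hMap_mem_unitCube hz.1 (hp.sub_cube hx) i).1,
    hMap_le hz (hp.sub_cube hx i).1⟩

/-- A perturbed point is a convex combination of x and c + r u. This gives feasibility of the
queries and exhibits the perturbed shrinking map as a homothety. -/
theorem shrink_add_smul (x u : Vec d) : shrink p.c p.r p.δ x + p.δ • u =
    (1 - p.δ / p.r) • x + (1 - (1 - p.δ / p.r)) • (p.c + p.r • u) := by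
  have h : (p.δ / p.r) • p.r • u = p.δ • u := by
    rw [smul_smul, div_mul_cancel₀ _ hp.r_pos.ne']
  rw [sub_sub_cancel, smul_add, h, shrink]
  module

theorem shrink_add_smul_mem {x u : Vec d} (hx : x ∈ p.K) (hu : u ∈ p.L₀) (hu1 : ‖u‖ ≤ 1) :
    shrink p.c p.r p.δ x + p.δ • u ∈ p.K := by
  rw [hp.shrink_add_smul]
  refine hp.convex hx (hp.add_mem (Submodule.smul_mem _ _ hu) ?_) hp.one_sub_pos.le ?_ (by ring)
  · rw [norm_smul, Real.norm_of_nonneg hp.r_pos.le]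
    exact mul_le_of_le_one_right hp.r_pos.le hu1
  · rw [sub_sub_cancel]; exact hp.ratio_pos.le

theorem shrink_mem {x : Vec d} (hx : x ∈ p.K) : shrink p.c p.r p.δ x ∈ p.K := by
  simpa using hp.shrink_add_smul_mem hx (Submodule.zero_mem _) (by simp)

theorem unshrink_shrink (x : Vec d) : unshrink p.c p.r p.δ (shrink p.c p.r p.δ x) = x := by
  simp [unshrink, shrink, smul_smul, inv_mul_cancel₀ hp.one_sub_pos.ne']

theorem shrink_unshrink (x : Vec d) : shrink p.c p.r p.δ (unshrink p.c p.r p.δ x) = x := by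
  simp [unshrink, shrink, smul_smul, mul_inv_cancel₀ hp.one_sub_pos.ne']

theorem unshrink_mem {x : Vec d} (hx : x ∈ p.dom) : unshrink p.c p.r p.δ x ∈ p.K := by
  obtain ⟨y, hy, rfl⟩ := hx
  rwa [hp.unshrink_shrink]

theorem dom_subset : p.dom ⊆ p.K := by
  rintro _ ⟨y, hy, rfl⟩
  exact hp.shrink_mem hy

theorem c_mem_dom : p.c ∈ p.dom := ⟨p.c, hp.c_mem, by simp [shrink]⟩

theorem isCompact_dom : IsCompact p.dom := hp.isCompact.image (continuous_shrink _ _ _)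

theorem nontrivial_dom : p.dom.Nontrivial := by
  refine hp.nontrivial.image_of_injOn fun x _ y _ h => ?_
  rw [← hp.unshrink_shrink x, h, hp.unshrink_shrink]

/-- The homothety of ratio `1 - ε / rDom` with centre `c`. -/
theorem pull_mem {y : Vec d} (hy : y ∈ p.K) : p.c + (1 - p.ε / p.rDom) • (y - p.c) ∈ p.K := by
  have h1 : p.ε / p.rDom ≤ 1 := ((div_lt_one hp.rDom_pos).2 hp.ε_lt).le
  have h2 : 0 ≤ p.ε / p.rDom := (div_pos hp.ε_pos hp.rDom_pos).le
  have := hp.convex hy hp.c_mem (sub_nonneg.2 h1) h2 (by ring)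
  convert this using 1
  module

/-- With a = 1 - δ/r, a displacement w of the image is the image of a convex combination of y and a
point c + (rDom/ε) a⁻¹ w of K. -/
theorem isDeep {y : Vec d} (hy : y ∈ p.K) :
    IsDeep p.dom p.ε (shrink p.c p.r p.δ (p.c + (1 - p.ε / p.rDom) • (y - p.c))) := by
  refine ⟨p.shrink_mem_dom (hp.pull_mem hy), fun w hw hwε => ?_⟩
  have hw := p.vectorSpan_dom_le hw
  have hr := hp.rDom_pos
  have hε := hp.ε_pos
  have ha := hp.one_sub_pos
  have hra : (1 - p.δ / p.r) * p.r = p.rDom := by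
    have := hp.r_pos
    rw [Input.rDom]; field_simp
  set a := 1 - p.δ / p.r with haa
  have h1 : p.ε / p.rDom ≤ 1 := ((div_lt_one hr).2 hp.ε_lt).le
  -- As rDom = a r, the norm bound ‖w‖ ≤ ε becomes exactly r after this scaling.
  have hmem : p.c + (p.rDom / p.ε * a⁻¹) • w ∈ p.K := by
    refine hp.add_mem (Submodule.smul_mem _ _ hw) ?_
    rw [norm_smul, Real.norm_of_nonneg (by positivity)]
    calc p.rDom / p.ε * a⁻¹ * ‖w‖ ≤ p.rDom / p.ε * a⁻¹ * p.ε := by gcongr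
      _ = p.r := by rw [← hra]; field_simp
  refine ⟨_, hp.convex hy hmem (sub_nonneg.2 h1) (div_pos hε hr).le (by ring), ?_⟩
  have h2 : (p.ε / p.rDom) • (p.rDom / p.ε * a⁻¹) • w = a⁻¹ • w := by
    rw [smul_smul]; congr 1; field_simp
  have h3 : a • a⁻¹ • w = w := smul_inv_smul₀ ha.ne' w
  rw [smul_add, h2, shrink, shrink, ← haa]
  conv_rhs => rw [← h3]
  module

theorem soip_mem_dom (y : Vec d) : soip p.dom p.c p.so p.ε y ∈ p.dom :=
  soip_mem hp.oracle hp.ε_pos hp.c_mem_dom (hp.isDeep hp.c_mem) y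

theorem measurable_soip_dom : Measurable (soip p.dom p.c p.so p.ε) :=
  measurable_soip hp.isCompact_dom.isClosed.measurableSet hp.oracle hp.ε_pos hp.c_mem_dom
    (hp.isDeep hp.c_mem)

/-- No restriction on the samples is needed, since the projection always ends in the domain; only
the query points require an almost sure statement. -/
theorem iter_mem (z : ℕ → ℝ) (u : ℕ → Vec d) (o : ℕ → ℝ) (t : ℕ) : p.iter z u o t ∈ p.dom := by
  cases t with
  | zero => exact hp.c_mem_dom
  | succ t => exact hp.soip_mem_dom _

theorem action_mem (z : ℕ → ℝ) (u : ℕ → Vec d) (o : ℕ → ℝ) (t : ℕ) : p.action z u o t ∈ p.K :=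
  hp.shrink_mem (hp.hMap_mem (hp.unshrink_mem (hp.iter_mem z u o t)) ⟨zero_le_one, le_rfl⟩)

theorem query_mem {z : ℕ → ℝ} {u : ℕ → Vec d} (o : ℕ → ℝ) {t : ℕ}
    (hz : z t ∈ Set.Icc (0 : ℝ) 1) (hu : u t ∈ p.L₀) (hu1 : ‖u t‖ = 1) : p.query z u o t ∈ p.K :=
  hp.shrink_add_smul_mem (hp.hMap_mem (hp.unshrink_mem (hp.iter_mem z u o t)) hz) hu hu1.le

theorem nontrivial_L₀ : Nontrivial p.L₀ := by
  obtain ⟨x, hx, y, hy, hxy⟩ := hp.nontrivial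
  exact ⟨⟨⟨x, hp.mem_L₀ hx⟩, ⟨y, hp.mem_L₀ hy⟩, fun h => hxy (congrArg Subtype.val h)⟩⟩

end Input.Valid

/-! ### The sampling laws of z and u. -/

section SamplingLaws

theorem one_sub_exp_neg_one_pos : 0 < 1 - Real.exp (-1) := by
  have : Real.exp (-1) < Real.exp 0 := Real.exp_lt_exp.2 (by norm_num)
  rw [Real.exp_zero] at this
  linarith

theorem integral_bqndLaw (φ : ℝ → ℝ) : ∫ z, φ z ∂bqndLaw =
    (1 - Real.exp (-1))⁻¹ * ∫ z in Set.Icc (0 : ℝ) 1, Real.exp (z - 1) * φ z := by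
  have hpos := one_sub_exp_neg_one_pos
  rw [bqndLaw, integral_withDensity_eq_integral_toReal_smul (by fun_prop)
    (.of_forall fun _ => ENNReal.ofReal_lt_top), ← integral_const_mul]
  refine integral_congr_ae (.of_forall fun z => ?_)
  simp only [smul_eq_mul]
  rw [ENNReal.toReal_ofReal (by positivity)]
  ring

instance : IsProbabilityMeasure bqndLaw := by
  have hpos := one_sub_exp_neg_one_pos
  have hint : IntegrableOn (fun z : ℝ => Real.exp (z - 1) / (1 - Real.exp (-1)))
      (Set.Icc 0 1) := (Continuous.integrableOn_Icc (by fun_prop))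
  constructor
  rw [bqndLaw, withDensity_apply _ MeasurableSet.univ, Measure.restrict_univ,
    ← ofReal_integral_eq_lintegral_ofReal hint (.of_forall fun z => by positivity),
    integral_Icc_eq_integral_Ioc, ← intervalIntegral.integral_of_le zero_le_one,
    intervalIntegral.integral_div, intervalIntegral.integral_comp_sub_right (fun z => Real.exp z),
    integral_exp]
  simp [div_self hpos.ne']

theorem ae_bqndLaw : ∀ᵐ z ∂bqndLaw, z ∈ Set.Icc (0 : ℝ) 1 :=
  (withDensity_absolutelyContinuous _ _).ae_le (ae_restrict_mem measurableSet_Icc)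

variable (L : Submodule ℝ (Vec d))

theorem measurableEmbedding_sphere :
    MeasurableEmbedding fun u : Metric.sphere (0 : L) 1 => ((u : L) : Vec d) :=
  (MeasurableEmbedding.subtype_coe L.closed_of_finiteDimensional.measurableSet).comp
    (MeasurableEmbedding.subtype_coe Metric.isClosed_sphere.measurableSet)

/-- The surface measure has mass dim L times the volume of the ball; this dimension cancels the
factor k of the gradient estimate. -/
theorem integral_uniformSphere (φ : Vec d → ℝ) : ∫ u, φ u ∂(uniformSphere L) =
    (Module.finrank ℝ L * (volume : Measure L).real (Metric.ball 0 1))⁻¹ *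
      ∫ u : Metric.sphere (0 : L) 1, φ ((u : L) : Vec d) ∂(volume : Measure L).toSphere := by
  rw [uniformSphere, integral_smul_measure, (measurableEmbedding_sphere L).integral_map,
    ENNReal.toReal_inv, ← Measure.toSphere_real_apply_univ]
  rfl

theorem isProbabilityMeasure_uniformSphere [Nontrivial L] :
    IsProbabilityMeasure (uniformSphere L) := by
  constructor
  rw [uniformSphere, Measure.smul_apply, Measure.map_apply (measurableEmbedding_sphere L).measurable
    MeasurableSet.univ, Set.preimage_univ, smul_eq_mul]
  refine ENNReal.inv_mul_cancel ?_ (measure_ne_top _ _)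
  rw [Ne, Measure.measure_univ_eq_zero]
  exact Measure.toSphere_ne_zero _

theorem ae_uniformSphere : ∀ᵐ u ∂(uniformSphere L), u ∈ L ∧ ‖u‖ = 1 := by
  refine Measure.ae_smul_measure ?_ _
  rw [(measurableEmbedding_sphere L).ae_map_iff]
  exact .of_forall fun u => ⟨(u : L).2, mem_sphere_zero_iff_norm.1 u.2⟩

theorem ae_sample [Nontrivial L] : ∀ᵐ q ∂(bqndLaw.prod (uniformSphere L)),
    q.1 ∈ Set.Icc (0 : ℝ) 1 ∧ q.2 ∈ L ∧ ‖q.2‖ = 1 := by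
  have := isProbabilityMeasure_uniformSphere L
  exact (Measure.quasiMeasurePreserving_fst.ae ae_bqndLaw).and
    (Measure.quasiMeasurePreserving_snd.ae (ae_uniformSphere L))

end SamplingLaws

/-! ### Lipschitz bounds and extension beyond K. -/

section Lipschitz

theorem IsDRSubmodular.nonneg_bound {K : Set (Vec d)} {M₁ : ℝ} {f : Vec d → ℝ}
    (hf : IsDRSubmodular K M₁ f) (hK : K.Nonempty) : 0 ≤ M₁ := by
  obtain ⟨-, g, -, -, hg⟩ := hf
  obtain ⟨x, hx⟩ := hK
  exact (norm_nonneg _).trans (hg x hx)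

theorem IsDRSubmodular.abs_sub_le {K : Set (Vec d)} {M₁ : ℝ} {f : Vec d → ℝ}
    (hf : IsDRSubmodular K M₁ f) (hK : K ⊆ unitCube d) (hc : Convex ℝ K) {x y : Vec d}
    (hx : x ∈ K) (hy : y ∈ K) : |f x - f y| ≤ M₁ * ‖x - y‖ := by
  obtain ⟨-, g, hgrad, -, hg⟩ := hf
  exact hc.norm_image_sub_le_of_norm_hasFDerivWithin_le
    (fun x hx => (hgrad x (hK hx)).hasFDerivWithinAt.mono hK)
    (fun x hx => by rw [LinearIsometryEquiv.norm_map]; exact hg x hx) hy hx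

/-- The extension supplies continuity, measurability and bounded line derivatives on the whole
space, which f itself lacks. -/
theorem IsDRSubmodular.exists_extension {K : Set (Vec d)} {M₁ : ℝ} {f : Vec d → ℝ}
    (hf : IsDRSubmodular K M₁ f) (hK : K ⊆ unitCube d) (hc : Convex ℝ K) (hne : K.Nonempty) :
    ∃ F : Vec d → ℝ, LipschitzWith M₁.toNNReal F ∧ Set.EqOn f F K := by
  refine LipschitzOnWith.extend_real (LipschitzOnWith.of_dist_le_mul fun x hx y hy => ?_)
  rw [Real.dist_eq, dist_eq_norm, Real.coe_toNNReal _ (hf.nonneg_bound hne)]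
  exact hf.abs_sub_le hK hc hx hy

end Lipschitz

/-! ### Integrability of the gradient estimate. -/

section Smoothing

/-- The contribution of the samples `q = (z, u)` to the linearized regret at `shrink ξ` in the
direction `w`. -/
def gradTerm (p : Input d) (F : Vec d → ℝ) (w ξ : Vec d) (q : ℝ × Vec d) : ℝ :=
  p.k / p.δ * F (shrink p.c p.r p.δ (hMap q.1 ξ) + p.δ • q.2) * inner ℝ (expScale q.1 ξ q.2) w

theorem continuous_gradTerm (p : Input d) {F : Vec d → ℝ} (hF : Continuous F) :
    Continuous fun m : Vec d × Vec d × ℝ × Vec d => gradTerm p F m.1 m.2.1 m.2.2 := by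
  have h1 : Continuous fun m : Vec d × Vec d × ℝ × Vec d => hMap m.2.2.1 m.2.1 :=
    continuous_hMap.comp (continuous_snd.snd.fst.prodMk continuous_snd.fst)
  have h2 : Continuous fun m : Vec d × Vec d × ℝ × Vec d => expScale m.2.2.1 m.2.1 m.2.2.2 :=
    continuous_expScale.comp (continuous_snd.snd.fst.prodMk
      (continuous_snd.fst.prodMk continuous_snd.snd.snd))
  have h3 := (continuous_shrink p.c p.r p.δ).comp h1
  have h4 : Continuous fun m : Vec d × Vec d × ℝ × Vec d =>
      shrink p.c p.r p.δ (hMap m.2.2.1 m.2.1) + p.δ • m.2.2.2 := h3.add (by fun_prop)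
  unfold gradTerm
  exact (continuous_const.mul (hF.comp h4)).mul (h2.inner continuous_fst)

variable {p : Input d}

theorem Input.Valid.exists_abs_gradTerm_le (hp : p.Valid) {F : Vec d → ℝ} (hF : Continuous F)
    {S : Set (Vec d)} (hS : IsCompact S) : ∃ B, ∀ w ∈ S, ∀ ξ ∈ p.K, ∀ q : ℝ × Vec d,
      q.1 ∈ Set.Icc (0 : ℝ) 1 → ‖q.2‖ = 1 → ‖gradTerm p F w ξ q‖ ≤ B := by
  obtain ⟨B, hB⟩ := (hS.prod (hp.isCompact.prod ((isCompact_Icc (a := (0 : ℝ)) (b := 1)).prod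
    (isCompact_sphere (0 : Vec d) 1)))).exists_bound_of_continuousOn
    (continuous_gradTerm p hF).continuousOn
  exact ⟨B, fun w hw ξ hξ q h1 h2 => hB (w, ξ, q) ⟨hw, hξ, h1, by simpa using h2⟩⟩

theorem Input.Valid.integrable_gradTerm (hp : p.Valid) {F : Vec d → ℝ} (hF : Continuous F)
    (w : Vec d) {ξ : Vec d} (hξ : ξ ∈ p.K) :
    Integrable (gradTerm p F w ξ) (bqndLaw.prod (uniformSphere p.L₀)) := by
  have := hp.nontrivial_L₀
  have := isProbabilityMeasure_uniformSphere p.L₀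
  obtain ⟨B, hB⟩ := hp.exists_abs_gradTerm_le hF (isCompact_singleton (x := w))
  refine Integrable.of_bound (C := B) ?_ ?_
  · exact ((continuous_gradTerm p hF).comp
      (continuous_const.prodMk (continuous_const.prodMk continuous_id))).aestronglyMeasurable
  · filter_upwards [ae_sample p.L₀] with q hq
    exact hB w rfl ξ hξ q hq.1 hq.2.2

end Smoothing

/-! ### Linearization through function values. -/

section SmoothedLinearization

variable {p : Input d}

open scoped NNReal

/-- The line derivative of `F` at a perturbed query point, in the direction `expScale z ξ w`. -/
def queryDeriv (p : Input d) (F : Vec d → ℝ) (w ξ : Vec d) (z : ℝ) (x : p.L₀) : ℝ :=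
  lineDeriv ℝ F (shrink p.c p.r p.δ (hMap z ξ) + p.δ • (x : Vec d)) (expScale z ξ w)

theorem measurable_queryDeriv (p : Input d) {F : Vec d → ℝ} (hF : Continuous F) (w ξ : Vec d) :
    Measurable fun m : p.L₀ × ℝ => queryDeriv p F w ξ m.2 m.1 := by
  have h1 : Continuous fun m : p.L₀ × ℝ => shrink p.c p.r p.δ (hMap m.2 ξ) :=
    (continuous_shrink p.c p.r p.δ).comp
      (continuous_hMap.comp (continuous_snd.prodMk continuous_const))
  have h2 : Continuous fun m : p.L₀ × ℝ => p.δ • (m.1 : Vec d) := by fun_prop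
  have h3 : Continuous fun m : p.L₀ × ℝ => expScale m.2 ξ w :=
    continuous_expScale.comp
      (continuous_snd.prodMk (continuous_const (y := ((ξ, w) : Vec d × Vec d))))
  exact (measurable_lineDeriv_uncurry hF).comp ((h1.add h2).prodMk h3).measurable

theorem abs_queryDeriv_le {C : ℝ≥0} {F : Vec d → ℝ} (hF : LipschitzWith C F) (w : Vec d)
    {ξ : Vec d} (hξ : ξ ∈ unitCube d) {z : ℝ} (hz : 0 ≤ z) (x : p.L₀) :
    ‖queryDeriv p F w ξ z x‖ ≤ C * ‖w‖ :=
  (norm_lineDeriv_le_of_lipschitz ℝ hF).trans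
    (mul_le_mul_of_nonneg_left (norm_expScale_le hz hξ w) C.2)

theorem measurable_exp_mul_queryDeriv (p : Input d) {F : Vec d → ℝ} (hF : Continuous F)
    (w ξ : Vec d) :
    Measurable fun m : p.L₀ × ℝ => Real.exp (m.2 - 1) * queryDeriv p F w ξ m.2 m.1 := by
  have h2 : Measurable fun m : p.L₀ × ℝ => Real.exp (m.2 - 1) := by fun_prop
  exact h2.mul (measurable_queryDeriv p hF w ξ)

theorem abs_exp_mul_queryDeriv_le {C : ℝ≥0} {F : Vec d → ℝ} (hF : LipschitzWith C F) (w : Vec d)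
    {ξ : Vec d} (hξ : ξ ∈ unitCube d) {z : ℝ} (hz : z ∈ Set.Icc (0 : ℝ) 1) (x : p.L₀) :
    ‖Real.exp (z - 1) * queryDeriv p F w ξ z x‖ ≤ C * ‖w‖ := by
  rw [norm_mul, Real.norm_of_nonneg (Real.exp_pos _).le]
  refine (mul_le_of_le_one_left (norm_nonneg _) ?_).trans (abs_queryDeriv_le hF w hξ hz.1 x)
  rw [Real.exp_le_one_iff]
  linarith [hz.2]

/-- The one-point gradient estimate is unbiased for the gradient of the smoothed function. -/
theorem Input.Valid.setIntegral_queryDeriv (hp : p.Valid) {C : ℝ≥0} {F : Vec d → ℝ}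
    (hF : LipschitzWith C F) {w : Vec d} (hw : w ∈ p.L₀) (ξ : Vec d) (z : ℝ) :
    ∫ x in Metric.ball 0 1, queryDeriv p F w ξ z x =
      p.δ⁻¹ * ∫ u : Metric.sphere (0 : p.L₀) 1,
        F (shrink p.c p.r p.δ (hMap z ξ) + p.δ • ((u : p.L₀) : Vec d)) *
          inner ℝ (expScale z ξ ((u : p.L₀) : Vec d)) w ∂(volume : Measure p.L₀).toSphere := by
  have := hp.nontrivial_L₀
  set b := shrink p.c p.r p.δ (hMap z ξ)
  let v : p.L₀ := ⟨expScale z ξ w, hp.expScale_mem_L₀ z ξ hw⟩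
  have hl : LipschitzWith (C * p.δ.toNNReal) fun x : p.L₀ => F (b + p.δ • (x : Vec d)) := by
    refine hF.comp (LipschitzWith.of_dist_le_mul fun x y => ?_)
    rw [dist_add_left, dist_smul₀, Real.norm_of_nonneg hp.δ_pos.le,
      Real.coe_toNNReal _ hp.δ_pos.le]
    exact le_rfl
  have hd : ∀ x : p.L₀, lineDeriv ℝ (fun x : p.L₀ => F (b + p.δ • (x : Vec d))) x v =
      p.δ * queryDeriv p F w ξ z x := by
    intro x
    rw [queryDeriv, ← smul_eq_mul, ← lineDeriv_smul]
    unfold lineDeriv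
    congr 1
    ext t
    simp only [Submodule.coe_add, Submodule.coe_smul, v, b, smul_add, smul_smul, mul_comm p.δ t,
      add_assoc]
  have key := setIntegral_ball_lineDeriv (volume : Measure p.L₀) hl v
  simp only [hd, integral_const_mul] at key
  rw [eq_inv_mul_iff_mul_eq₀ hp.δ_pos.ne', key]
  refine integral_congr_ae (.of_forall fun u => ?_)
  -- Scaling by e^{-zξ} is self-adjoint, so it passes from the direction w to the sample u, where
  -- the algorithm applies it.
  simp only [inner_expScale_left]
  rfl

/-- For x in the open ball and a direction in L₀, small moves stay in K, where F and f agree. -/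
theorem Input.Valid.queryDeriv_eq (hp : p.Valid) {F f : Vec d → ℝ} {g : Vec d → Vec d}
    (hg : ∀ x ∈ unitCube d, HasGradientWithinAt f (g x) (unitCube d) x)
    (hEq : Set.EqOn f F p.K) {w ξ : Vec d} (hw : w ∈ p.L₀) (hξ : ξ ∈ p.K) {z : ℝ}
    (hz : z ∈ Set.Icc (0 : ℝ) 1) {x : p.L₀} (hx : x ∈ Metric.ball (0 : p.L₀) 1) :
    queryDeriv p F w ξ z x =
      inner ℝ (g (shrink p.c p.r p.δ (hMap z ξ) + p.δ • (x : Vec d))) (expScale z ξ w) := by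
  have hδ := hp.δ_pos
  set b := shrink p.c p.r p.δ (hMap z ξ)
  set v := expScale z ξ w
  have hv : v ∈ p.L₀ := hp.expScale_mem_L₀ z ξ hw
  have hnear : ∀ᶠ t : ℝ in nhds 0, b + p.δ • (x : Vec d) + t • v ∈ p.K := by
    have hc : Filter.Tendsto (fun t : ℝ => ‖(x : Vec d) + (p.δ⁻¹ * t) • v‖) (nhds 0)
        (nhds ‖(x : Vec d)‖) := by
      have : ContinuousAt (fun t : ℝ => ‖(x : Vec d) + (p.δ⁻¹ * t) • v‖) 0 := by fun_prop
      simpa [ContinuousAt] using this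
    have hx1 : ‖(x : Vec d)‖ < 1 := by simpa using hx
    filter_upwards [hc.eventually_lt_const hx1] with t ht
    have := hp.shrink_add_smul_mem (hp.hMap_mem hξ hz)
      (Submodule.add_mem _ x.2 (Submodule.smul_mem _ (p.δ⁻¹ * t) hv)) ht.le
    convert this using 1
    rw [smul_add, smul_smul, mul_inv_cancel_left₀ hδ.ne', add_assoc]
  have hmem : b + p.δ • (x : Vec d) ∈ unitCube d := by
    have := hnear.self_of_nhds
    rw [zero_smul, add_zero] at this
    exact hp.sub_cube this
  have hγ : HasDerivWithinAt (fun t : ℝ => b + p.δ • (x : Vec d) + t • v) v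
      {t | b + p.δ • (x : Vec d) + t • v ∈ p.K} 0 := by
    simpa using (((hasDerivAt_id (0 : ℝ)).smul_const v).const_add
      (b + p.δ • (x : Vec d))).hasDerivWithinAt
  have hb0 : b + p.δ • (x : Vec d) + (0 : ℝ) • v = b + p.δ • (x : Vec d) := by simp
  have h1 := (hb0.symm ▸ (hg _ hmem).hasFDerivWithinAt :
    HasFDerivWithinAt f _ (unitCube d) (b + p.δ • (x : Vec d) + (0 : ℝ) • v)).comp_hasDerivWithinAt
    0 hγ fun t ht => hp.sub_cube ht
  have h2 := h1.hasDerivAt hnear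
  have h3 : (fun t : ℝ => F (b + p.δ • (x : Vec d) + t • v)) =ᶠ[nhds 0]
      f ∘ fun t : ℝ => b + p.δ • (x : Vec d) + t • v := by
    filter_upwards [hnear] with t ht
    exact (hEq ht).symm
  rw [queryDeriv, lineDeriv, h3.deriv_eq, h2.deriv]
  simp [v, b]

/-- The curve inequality is applied to f precomposed with the homothety centred at c + r x; its
ratio is the factor 1 - δ/r. Fixing x avoids differentiating a smoothed function. -/
theorem Input.Valid.linearization_at (hp : p.Valid) {M₁ : ℝ} {f F : Vec d → ℝ} {C : ℝ≥0}
    (hf : IsDRSubmodular p.K M₁ f) (hF : LipschitzWith C F) (hEq : Set.EqOn f F p.K)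
    {y ξ : Vec d} (hy : y ∈ p.K) (hξ : ξ ∈ p.K) {x : p.L₀}
    (hx : x ∈ Metric.ball (0 : p.L₀) 1) :
    Real.exp (-1) * f (shrink p.c p.r p.δ y + p.δ • (x : Vec d)) -
        f (shrink p.c p.r p.δ (hMap 1 ξ) + p.δ • (x : Vec d)) ≤
      (1 - p.δ / p.r) * ∫ z in Set.Icc (0 : ℝ) 1,
        Real.exp (z - 1) * queryDeriv p F (y - ξ) ξ z x := by
  obtain ⟨hnn, g, hg, hanti, -⟩ := hf
  have hx1 : ‖(x : Vec d)‖ ≤ 1 := by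
    have : ‖(x : Vec d)‖ < 1 := by simpa using hx
    exact this.le
  have hw : y - ξ ∈ p.L₀ := sub_mem_vectorSpan hy hξ
  have hb : p.c + p.r • (x : Vec d) ∈ unitCube d := by
    refine hp.sub_cube (hp.add_mem (Submodule.smul_mem _ _ x.2) ?_)
    rw [norm_smul, Real.norm_of_nonneg hp.r_pos.le]
    exact mul_le_of_le_one_right hp.r_pos.le hx1
  have hDR := (HasDRGradient.mk hnn hg hanti).comp_homothety
    (a := 1 - p.δ / p.r) ⟨hp.one_sub_pos.le, by linarith [hp.ratio_pos]⟩ hb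
  have hq : ∀ z ∈ Set.Icc (0 : ℝ) 1, Real.exp (z - 1) *
      inner ℝ ((1 - p.δ / p.r) • g ((1 - p.δ / p.r) • hMap z ξ +
        (1 - (1 - p.δ / p.r)) • (p.c + p.r • (x : Vec d)))) (expScale z ξ (y - ξ)) =
      (1 - p.δ / p.r) * (Real.exp (z - 1) * queryDeriv p F (y - ξ) ξ z x) := by
    intro z hz
    rw [hp.queryDeriv_eq hg hEq hw hξ hz hx, ← hp.shrink_add_smul, inner_smul_left, conj_trivial]
    ring
  have hint : IntegrableOn (fun z => (1 - p.δ / p.r) *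
      (Real.exp (z - 1) * queryDeriv p F (y - ξ) ξ z x)) (Set.Icc 0 1) := by
    refine Integrable.const_mul ?_ _
    refine Measure.integrableOn_of_bounded (M := C * ‖y - ξ‖) (by simp) ?_ ?_
    · exact ((measurable_exp_mul_queryDeriv p hF.continuous (y - ξ) ξ).comp
        (measurable_const.prodMk measurable_id)).aestronglyMeasurable
    · exact (ae_restrict_iff' measurableSet_Icc).2 (.of_forall fun z hz =>
        abs_exp_mul_queryDeriv_le hF _ (hp.sub_cube hξ) hz x)
  have key := hDR.exp_neg_one_mul_sub_le (hp.sub_cube hξ) (hp.sub_cube hy)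
    (hint.congr_fun (fun z hz => (hq z hz).symm) measurableSet_Icc)
  rw [intervalIntegral.integral_of_le zero_le_one, ← integral_Icc_eq_integral_Ioc,
    setIntegral_congr_fun measurableSet_Icc hq, integral_const_mul, ← hp.shrink_add_smul,
    ← hp.shrink_add_smul] at key
  exact key

/-- The loss caused by the smoothing and by moving the comparator into the shrunk domain. -/
def shrinkLoss (p : Input d) (M₁ : ℝ) : ℝ :=
  M₁ * √d * (p.δ / p.r + p.ε / p.rDom) + M₁ * p.δ

/-- The comparator moves by fractions ε/rDom and δ/r of vectors of length at most √d, the action by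
at most δ. -/
theorem Input.Valid.le_linearization_at (hp : p.Valid) {M₁ : ℝ} {f : Vec d → ℝ}
    (hf : IsDRSubmodular p.K M₁ f) {y ξ : Vec d} (hy : y ∈ p.K) (hξ : ξ ∈ p.K)
    {x : Vec d} (hx : x ∈ p.L₀) (hx1 : ‖x‖ ≤ 1) :
    Real.exp (-1) * f y - f (shrink p.c p.r p.δ (hMap 1 ξ)) - shrinkLoss p M₁ ≤
      Real.exp (-1) * f (shrink p.c p.r p.δ (p.c + (1 - p.ε / p.rDom) • (y - p.c)) + p.δ • x) -
        f (shrink p.c p.r p.δ (hMap 1 ξ) + p.δ • x) := by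
  have hM := hf.nonneg_bound ⟨_, hp.c_mem⟩
  set y' := p.c + (1 - p.ε / p.rDom) • (y - p.c) with hy'
  have hy'K : y' ∈ p.K := hp.pull_mem hy
  have hcx : p.c + p.r • x ∈ p.K := by
    refine hp.add_mem (Submodule.smul_mem _ _ hx) ?_
    rw [norm_smul, Real.norm_of_nonneg hp.r_pos.le]
    exact mul_le_of_le_one_right hp.r_pos.le hx1
  have h1 := (abs_le.1 (hf.abs_sub_le hp.sub_cube hp.convex hy
    (hp.shrink_add_smul_mem hy'K hx hx1))).2
  have h2 := (abs_le.1 (hf.abs_sub_le hp.sub_cube hp.convex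
    (hp.shrink_add_smul_mem (hp.hMap_mem hξ ⟨zero_le_one, le_rfl⟩) hx hx1)
    (hp.shrink_mem (hp.hMap_mem hξ ⟨zero_le_one, le_rfl⟩)))).2
  have h3 : ‖y - (shrink p.c p.r p.δ y' + p.δ • x)‖ ≤ √d * (p.δ / p.r + p.ε / p.rDom) := by
    have he : y - (shrink p.c p.r p.δ y' + p.δ • x) =
        (p.ε / p.rDom) • (y - p.c) + (p.δ / p.r) • (y' - (p.c + p.r • x)) := by
      rw [hp.shrink_add_smul, hy']; module
    rw [he]
    refine (norm_add_le _ _).trans ?_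
    rw [norm_smul, norm_smul, Real.norm_of_nonneg (div_pos hp.ε_pos hp.rDom_pos).le,
      Real.norm_of_nonneg hp.ratio_pos.le]
    have h4 := mul_le_mul_of_nonneg_left
      (norm_sub_le_sqrt (hp.sub_cube hy) (hp.sub_cube hp.c_mem))
      (div_pos hp.ε_pos hp.rDom_pos).le
    have h5 := mul_le_mul_of_nonneg_left
      (norm_sub_le_sqrt (hp.sub_cube hy'K) (hp.sub_cube hcx)) hp.ratio_pos.le
    linarith
  have h4 : ‖shrink p.c p.r p.δ (hMap 1 ξ) + p.δ • x - shrink p.c p.r p.δ (hMap 1 ξ)‖ ≤ p.δ := by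
    rw [add_sub_cancel_left, norm_smul, Real.norm_of_nonneg hp.δ_pos.le]
    exact mul_le_of_le_one_right hp.δ_pos.le hx1
  have h5 := mul_le_mul_of_nonneg_left h3 hM
  have h6 := mul_le_mul_of_nonneg_left h4 hM
  have h7 : Real.exp (-1) ≤ 1 := by linarith [one_sub_exp_neg_one_pos]
  have h8 : Real.exp (-1) *
      (f y - f (shrink p.c p.r p.δ y' + p.δ • x)) ≤ M₁ * (√d * (p.δ / p.r + p.ε / p.rDom)) := by
    have h9 : 0 ≤ M₁ * (√d * (p.δ / p.r + p.ε / p.rDom)) := (norm_nonneg _ |> mul_nonneg hM).trans h5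
    calc _ ≤ Real.exp (-1) * (M₁ * (√d * (p.δ / p.r + p.ε / p.rDom))) :=
          mul_le_mul_of_nonneg_left (h1.trans h5) (Real.exp_pos _).le
      _ ≤ _ := mul_le_of_le_one_left h9 h7
  rw [shrinkLoss]
  linarith

/-- The inequalities for fixed x are averaged over the unit ball of L₀. After Fubini, the divergence
theorem is applied for each z; 1 - e^{-1} cancels the normalization of the law of z. -/
theorem Input.Valid.linearization (hp : p.Valid) {M₁ : ℝ} {f F : Vec d → ℝ} {C : ℝ≥0}
    (hf : IsDRSubmodular p.K M₁ f) (hF : LipschitzWith C F) (hEq : Set.EqOn f F p.K)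
    {y ξ : Vec d} (hy : y ∈ p.K) (hξ : ξ ∈ p.K) :
    Real.exp (-1) * f y - f (shrink p.c p.r p.δ (hMap 1 ξ)) - shrinkLoss p M₁ ≤
      (1 - Real.exp (-1)) * ∫ q, gradTerm p F
        (shrink p.c p.r p.δ (p.c + (1 - p.ε / p.rDom) • (y - p.c)) - shrink p.c p.r p.δ ξ) ξ q
        ∂(bqndLaw.prod (uniformSphere p.L₀)) := by
  have := hp.nontrivial_L₀
  have := isProbabilityMeasure_uniformSphere p.L₀
  have he := one_sub_exp_neg_one_pos
  have ha := hp.one_sub_pos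
  have hδ := hp.δ_pos
  set y' := p.c + (1 - p.ε / p.rDom) • (y - p.c)
  have hy' : y' ∈ p.K := hp.pull_mem hy
  have hw : y' - ξ ∈ p.L₀ := sub_mem_vectorSpan hy' hξ
  set A := Real.exp (-1) * f y - f (shrink p.c p.r p.δ (hMap 1 ξ)) - shrinkLoss p M₁
  set V := (volume : Measure p.L₀).real (Metric.ball 0 1) with hV
  have hVpos : 0 < V := ENNReal.toReal_pos (Metric.measure_ball_pos _ _ zero_lt_one).ne'
    measure_ball_lt_top.ne
  have hk : 0 < (p.k : ℝ) := by exact_mod_cast Module.finrank_pos (R := ℝ) (M := p.L₀)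
  let H : p.L₀ → ℝ → ℝ := fun x z => Real.exp (z - 1) * queryDeriv p F (y' - ξ) ξ z x
  have hH : Integrable (Function.uncurry H)
      (((volume : Measure p.L₀).restrict (Metric.ball 0 1)).prod
        (volume.restrict (Set.Icc (0 : ℝ) 1))) := by
    have : IsFiniteMeasure ((volume : Measure p.L₀).restrict (Metric.ball 0 1)) :=
      ⟨by rw [Measure.restrict_apply_univ]; exact measure_ball_lt_top⟩
    refine Integrable.of_bound (C := C * ‖y' - ξ‖)
      (measurable_exp_mul_queryDeriv p hF.continuous (y' - ξ) ξ).aestronglyMeasurable ?_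
    filter_upwards [Measure.quasiMeasurePreserving_snd.ae (ae_restrict_mem measurableSet_Icc)]
      with m hm
    exact abs_exp_mul_queryDeriv_le hF _ (hp.sub_cube hξ) hm _
  have hpt : ∀ x ∈ Metric.ball (0 : p.L₀) 1,
      A ≤ (1 - p.δ / p.r) * ∫ z in Set.Icc (0 : ℝ) 1, H x z := by
    intro x hx
    have hx1 : ‖(x : Vec d)‖ < 1 := by simpa using hx
    exact (hp.le_linearization_at hf hy hξ x.2 hx1.le).trans
      (hp.linearization_at hf hF hEq hy' hξ hx)
  have h1 : A * V ≤ (1 - p.δ / p.r) *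
      ∫ x in Metric.ball (0 : p.L₀) 1, ∫ z in Set.Icc (0 : ℝ) 1, H x z := by
    have := setIntegral_mono_on (integrableOn_const measure_ball_lt_top.ne)
      (hH.integral_prod_left.const_mul (1 - p.δ / p.r)) measurableSet_ball hpt
    rw [setIntegral_const, integral_const_mul, smul_eq_mul, mul_comm] at this
    exact this
  rw [integral_integral_swap hH] at h1
  have h2 : ∀ z : ℝ, ∫ x in Metric.ball (0 : p.L₀) 1, H x z = Real.exp (z - 1) *
      (p.δ⁻¹ * ∫ u : Metric.sphere (0 : p.L₀) 1,
        F (shrink p.c p.r p.δ (hMap z ξ) + p.δ • ((u : p.L₀) : Vec d)) *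
          inner ℝ (expScale z ξ ((u : p.L₀) : Vec d)) (y' - ξ)
            ∂(volume : Measure p.L₀).toSphere) := by
    intro z
    rw [← hp.setIntegral_queryDeriv hF hw ξ z, ← integral_const_mul]
  have h3 : (1 - Real.exp (-1)) * ∫ q, gradTerm p F
        (shrink p.c p.r p.δ y' - shrink p.c p.r p.δ ξ) ξ q
        ∂(bqndLaw.prod (uniformSphere p.L₀)) =
      V⁻¹ * ((1 - p.δ / p.r) *
        ∫ z in Set.Icc (0 : ℝ) 1, ∫ x in Metric.ball (0 : p.L₀) 1, H x z) := by
    rw [integral_prod _ (hp.integrable_gradTerm hF.continuous _ hξ), integral_bqndLaw,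
      mul_inv_cancel_left₀ he.ne', ← integral_const_mul, ← integral_const_mul]
    refine integral_congr_ae (.of_forall fun z => ?_)
    simp only [h2, integral_uniformSphere, gradTerm, shrink_sub_shrink, inner_smul_right]
    rw [← hV, show (Module.finrank ℝ p.L₀ : ℝ) = p.k from rfl]
    have h4 : ∀ u : Metric.sphere (0 : p.L₀) 1,
        p.k / p.δ * F (shrink p.c p.r p.δ (hMap z ξ) + p.δ • ((u : p.L₀) : Vec d)) *
          ((1 - p.δ / p.r) * inner ℝ (expScale z ξ ((u : p.L₀) : Vec d)) (y' - ξ)) =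
        (p.k / p.δ * (1 - p.δ / p.r)) *
          (F (shrink p.c p.r p.δ (hMap z ξ) + p.δ • ((u : p.L₀) : Vec d)) *
          inner ℝ (expScale z ξ ((u : p.L₀) : Vec d)) (y' - ξ)) := fun u => by ring
    simp only [h4, integral_const_mul]
    field_simp
  rw [h3, le_inv_mul_iff₀ hVpos, mul_comm]
  exact h1

end SmoothedLinearization

/-! ### Measurability of the iterates. -/

section Iterates

variable {Ω : Type*} {m₀ : MeasurableSpace Ω}

/-- The point `x_t` of SO-OGA in a run. -/
def iterRV (p : Input d) (Z : ℕ → Ω → ℝ) (U : ℕ → Ω → Vec d) (O : ℕ → Ω → ℝ) (t : ℕ) (ω : Ω) :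
    Vec d :=
  p.iter (fun s => Z s ω) (fun s => U s ω) (fun s => O s ω) t

/-- The gradient estimate of round `t` in a run. -/
def gradRV (p : Input d) (Z : ℕ → Ω → ℝ) (U : ℕ → Ω → Vec d) (O : ℕ → Ω → ℝ) (t : ℕ) (ω : Ω) :
    Vec d :=
  bqndOutput p.c p.r p.δ (Z t ω) (iterRV p Z U O t ω) ((p.k / p.δ * O t ω) • U t ω)

theorem iterRV_succ (p : Input d) (Z : ℕ → Ω → ℝ) (U : ℕ → Ω → Vec d) (O : ℕ → Ω → ℝ) (t : ℕ)
    (ω : Ω) : iterRV p Z U O (t + 1) ω =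
      soip p.dom p.c p.so p.ε (iterRV p Z U O t ω + p.η • gradRV p Z U O t ω) := rfl

variable (Z : ℕ → Ω → ℝ) (U : ℕ → Ω → Vec d) (O : ℕ → Ω → ℝ)

theorem pastSigma_mono {s t : ℕ} (hst : s ≤ t) : pastSigma Z U O s ≤ pastSigma Z U O t :=
  iSup_mono fun _ => iSup_mono' fun h => ⟨h.trans_le hst, le_rfl⟩

theorem comap_le_pastSigma {s t : ℕ} (hst : s < t) :
    MeasurableSpace.comap (fun ω => (Z s ω, U s ω, O s ω)) inferInstance ≤ pastSigma Z U O t :=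
  le_iSup₂_of_le s hst le_rfl

theorem measurable_pastSigma {s t : ℕ} (hst : s < t) :
    Measurable[pastSigma Z U O t] fun ω => (Z s ω, U s ω, O s ω) :=
  (comap_measurable fun ω => (Z s ω, U s ω, O s ω)).mono (comap_le_pastSigma Z U O hst) le_rfl

theorem continuous_bqndOutput (p : Input d) : Continuous fun a : Vec d × ℝ × Vec d × ℝ =>
    bqndOutput p.c p.r p.δ a.2.1 a.1 ((p.k / p.δ * a.2.2.2) • a.2.2.1) :=
  continuous_expScale.comp (continuous_snd.fst.prodMk
    (((continuous_unshrink p.c p.r p.δ).comp continuous_fst).prodMk (by fun_prop)))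

theorem measurable_soogaStep {p : Input d} (hp : p.Valid) :
    Measurable fun a : Vec d × ℝ × Vec d × ℝ => soogaStep p.dom p.c p.so p.ε p.η a.1
      (bqndOutput p.c p.r p.δ a.2.1 a.1 ((p.k / p.δ * a.2.2.2) • a.2.2.1)) := by
  have h1 : Continuous fun a : Vec d × ℝ × Vec d × ℝ => a.1 + p.η •
      bqndOutput p.c p.r p.δ a.2.1 a.1 ((p.k / p.δ * a.2.2.2) • a.2.2.1) :=
    continuous_fst.add ((continuous_bqndOutput p).fun_const_smul p.η)
  exact hp.measurable_soip_dom.comp h1.measurable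

/-- Measurability with respect to the past is what yields independence from the samples of round t
and lets x_t leave the conditional expectation. -/
theorem measurable_iterRV {p : Input d} (hp : p.Valid) (t : ℕ) :
    Measurable[pastSigma Z U O t] (iterRV p Z U O t) := by
  induction t with
  | zero => exact measurable_const
  | succ t ih =>
    have h1 := ih.mono (pastSigma_mono Z U O t.le_succ) le_rfl
    have h2 : Measurable[pastSigma Z U O (t + 1)]
        fun ω => (iterRV p Z U O t ω, Z t ω, U t ω, O t ω) :=
      h1.prodMk (measurable_pastSigma Z U O t.lt_succ_self)
    have h3 := (measurable_soogaStep hp).comp h2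
    exact h3

end Iterates

theorem norm_sub_iterRV_le {Ω : Type*} {p : Input d} {Z : ℕ → Ω → ℝ} {U : ℕ → Ω → Vec d}
    {O : ℕ → Ω → ℝ} (hp : p.Valid) {y : Vec d} (hy : y ∈ p.K) (t : ℕ) (ω : Ω) :
    ‖y - iterRV p Z U O t ω‖ ≤ √d :=
  norm_sub_le_sqrt (hp.sub_cube hy) (hp.sub_cube (hp.dom_subset (hp.iter_mem _ _ _ t)))

/-! ### Expectations in a run. -/

section Run

variable {Ω : Type*} [m₀ : MeasurableSpace Ω] {p : Input d} {f : ℕ → Vec d → ℝ} {P : Measure Ω}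
  {Z : ℕ → Ω → ℝ} {U : ℕ → Ω → Vec d} {O : ℕ → Ω → ℝ}

theorem IsRun.pastSigma_le (hR : IsRun p f P Z U O) {t : ℕ} (ht : t ≤ p.T) :
    pastSigma Z U O t ≤ m₀ :=
  iSup₂_le fun s hs => Measurable.comap_le
    ((hR.measurable_Z s (by omega)).prodMk
      ((hR.measurable_U s (by omega)).prodMk (hR.measurable_O s (by omega))))

theorem IsRun.measurable_sample (hR : IsRun p f P Z U O) {t : ℕ} (ht : t < p.T) :
    Measurable fun ω => (Z t ω, U t ω) :=
  (hR.measurable_Z t ht).prodMk (hR.measurable_U t ht)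

theorem IsRun.measurable_iterRV (hR : IsRun p f P Z U O) (hp : p.Valid) {t : ℕ} (ht : t ≤ p.T) :
    Measurable (iterRV p Z U O t) :=
  (DRSub.measurable_iterRV Z U O hp t).mono (hR.pastSigma_le ht) le_rfl

theorem IsRun.ae_sample (hR : IsRun p f P Z U O) (hp : p.Valid) {t : ℕ} (ht : t < p.T) :
    ∀ᵐ ω ∂P, Z t ω ∈ Set.Icc (0 : ℝ) 1 ∧ U t ω ∈ p.L₀ ∧ ‖U t ω‖ = 1 := by
  have := hp.nontrivial_L₀
  have h := DRSub.ae_sample p.L₀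
  rw [← hR.law t ht] at h
  exact ae_of_ae_map (hR.measurable_sample ht).aemeasurable h

theorem IsRun.ae_mem (hR : IsRun p f P Z U O) (hp : p.Valid) :
    ∀ᵐ ω ∂P, ∀ t < p.T, actionRV p Z U O t ω ∈ p.K ∧ queryRV p Z U O t ω ∈ p.K := by
  refine (ae_all_iff.2 fun t => ?_)
  by_cases ht : t < p.T
  · filter_upwards [hR.ae_sample hp ht] with ω hω _
    exact ⟨hp.action_mem _ _ _ t, hp.query_mem _ hω.1 hω.2.1 hω.2.2⟩
  · exact .of_forall fun ω h => absurd h ht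

theorem IsRun.indepFun (hR : IsRun p f P Z U O) (hp : p.Valid) {t : ℕ} (ht : t < p.T) :
    IndepFun (iterRV p Z U O t) (fun ω => (Z t ω, U t ω)) P := by
  rw [IndepFun_iff_Indep]
  exact (indep_of_indep_of_le_right (hR.indep t ht)
    (DRSub.measurable_iterRV Z U O hp t).comap_le).symm

theorem IsRun.map_prod (hR : IsRun p f P Z U O) (hp : p.Valid) [IsProbabilityMeasure P] {t : ℕ}
    (ht : t < p.T) :
    P.map (fun ω => (iterRV p Z U O t ω, Z t ω, U t ω)) =
      (P.map (iterRV p Z U O t)).prod (bqndLaw.prod (uniformSphere p.L₀)) := by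
  rw [← hR.law t ht]
  exact (indepFun_iff_map_prod_eq_prod_map_map (hR.measurable_iterRV hp ht.le).aemeasurable
    (hR.measurable_sample ht).aemeasurable).1 (hR.indepFun hp ht)

theorem IsRun.integrable_action (hR : IsRun p f P Z U O) (hp : p.Valid) [IsProbabilityMeasure P]
    {F : Vec d → ℝ} (hF : Continuous F) {t : ℕ} (ht : t < p.T) (hEq : Set.EqOn (f t) F p.K) :
    Integrable (fun ω => f t (actionRV p Z U O t ω)) P := by
  obtain ⟨B, hB⟩ := hp.isCompact.exists_bound_of_continuousOn hF.continuousOn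
  have hmem : ∀ ω, actionRV p Z U O t ω ∈ p.K := fun ω => hp.action_mem _ _ _ t
  have h1 : (fun ω => f t (actionRV p Z U O t ω)) = fun ω => F (actionRV p Z U O t ω) :=
    funext fun ω => hEq (hmem ω)
  rw [h1]
  have h2 : Continuous fun x : Vec d => hShrunk p.c p.r p.δ 1 x :=
    (continuous_shrink p.c p.r p.δ).comp (continuous_hMap.comp
      (continuous_const.prodMk (continuous_unshrink p.c p.r p.δ)))
  exact Integrable.of_bound (C := B)
    (((hF.comp h2).measurable.comp (hR.measurable_iterRV hp ht.le)).aestronglyMeasurable)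
    (.of_forall fun ω => hB _ (hmem ω))

theorem IsRun.norm_gradRV_le (hR : IsRun p f P Z U O) (hp : p.Valid) {t : ℕ} (ht : t < p.T) :
    ∀ᵐ ω ∂P, ‖gradRV p Z U O t ω‖ ≤ p.B₁ := by
  filter_upwards [hR.ae_sample hp ht, hR.bounded t ht] with ω hω hO
  refine (norm_expScale_le hω.1.1 (hp.sub_cube (hp.unshrink_mem (hp.iter_mem _ _ _ t))) _).trans ?_
  have hk : 0 ≤ (p.k : ℝ) / p.δ := div_nonneg (Nat.cast_nonneg _) hp.δ_pos.le
  rw [norm_smul, hω.2.2, mul_one, norm_mul, Real.norm_of_nonneg hk, Real.norm_eq_abs, Input.B₁]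
  exact mul_le_mul_of_nonneg_left hO hk

theorem IsRun.measurable_gradRV (hR : IsRun p f P Z U O) (hp : p.Valid) {t : ℕ} (ht : t < p.T) :
    Measurable (gradRV p Z U O t) := by
  exact (continuous_bqndOutput p).measurable.comp ((hR.measurable_iterRV hp ht.le).prodMk ((hR.measurable_Z t ht).prodMk
    ((hR.measurable_U t ht).prodMk (hR.measurable_O t ht))))

theorem IsRun.integrable_inner (hR : IsRun p f P Z U O) (hp : p.Valid) [IsProbabilityMeasure P]
    {y : Vec d} (hy : y ∈ p.K) {t : ℕ} (ht : t < p.T) :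
    Integrable (fun ω => inner ℝ (gradRV p Z U O t ω) (y - iterRV p Z U O t ω)) P := by
  refine Integrable.of_bound (C := p.B₁ * √d) ?_ ?_
  · exact ((hR.measurable_gradRV hp ht).inner
      (measurable_const.sub (hR.measurable_iterRV hp ht.le))).aestronglyMeasurable
  · filter_upwards [hR.norm_gradRV_le hp ht] with ω hω
    exact (norm_inner_le_norm _ _).trans (mul_le_mul hω (norm_sub_iterRV_le hp hy t ω)
      (norm_nonneg _) ((norm_nonneg _).trans hω))

/-- The answer of the value oracle may be replaced by its conditional mean. -/
theorem IsRun.integral_inner_eq (hR : IsRun p f P Z U O) (hp : p.Valid) [IsProbabilityMeasure P]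
    {F : Vec d → ℝ} {t : ℕ} (ht : t < p.T) (hEq : Set.EqOn (f t) F p.K)
    {y : Vec d} (hy : y ∈ p.K) :
    ∫ ω, inner ℝ (gradRV p Z U O t ω) (y - iterRV p Z U O t ω) ∂P =
      ∫ ω, gradTerm p F (y - iterRV p Z U O t ω) (unshrink p.c p.r p.δ (iterRV p Z U O t ω))
        (Z t ω, U t ω) ∂P := by
  have hm0 : pastSigma Z U O t ⊔ sampleSigma Z U t ≤ m₀ := sup_le (hR.pastSigma_le ht.le) (hR.measurable_sample ht).comap_le
  let S : Ω → ℝ := fun ω => p.k / p.δ * inner ℝ (expScale (Z t ω)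
    (unshrink p.c p.r p.δ (iterRV p Z U O t ω)) (U t ω)) (y - iterRV p Z U O t ω)
  have hOS : ∀ ω, inner ℝ (gradRV p Z U O t ω) (y - iterRV p Z U O t ω) = (O t * S) ω := by
    intro ω
    simp only [gradRV, bqndOutput, expScale_smul, inner_smul_left, conj_trivial, S, Pi.mul_apply]
    ring
  have hS : StronglyMeasurable[pastSigma Z U O t ⊔ sampleSigma Z U t] S := by
    have h1 : Continuous fun a : Vec d × ℝ × Vec d => p.k / p.δ *
        inner ℝ (expScale a.2.1 (unshrink p.c p.r p.δ a.1) a.2.2) (y - a.1) :=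
      continuous_const.mul ((continuous_expScale.comp (continuous_snd.fst.prodMk
        (((continuous_unshrink p.c p.r p.δ).comp continuous_fst).prodMk
          continuous_snd.snd))).inner (continuous_const.sub continuous_fst))
    have h2 : Measurable[pastSigma Z U O t ⊔ sampleSigma Z U t] (iterRV p Z U O t) :=
      (DRSub.measurable_iterRV Z U O hp t).mono le_sup_left le_rfl
    have h3 : Measurable[pastSigma Z U O t ⊔ sampleSigma Z U t] fun ω => (Z t ω, U t ω) :=
      (comap_measurable fun ω => (Z t ω, U t ω)).mono le_sup_right le_rfl
    exact (h1.measurable.comp (h2.prodMk h3)).stronglyMeasurable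
  have hO : Integrable (O t) P := Integrable.of_bound (C := p.B₀)
    (hR.measurable_O t ht).aestronglyMeasurable (hR.bounded t ht)
  have hint : Integrable (O t * S) P := (hR.integrable_inner hp hy ht).congr (.of_forall hOS)
  rw [integral_congr_ae (.of_forall hOS), ← integral_condExp hm0]
  refine integral_congr_ae ?_
  -- The factor S is known from the past and the samples, so only `O t` is averaged, and
  -- unbiasedness applies.
  filter_upwards [condExp_mul_of_stronglyMeasurable_right hS hint hO, hR.unbiased t ht,
    hR.ae_mem hp] with ω h1 h2 h3
  rw [h1, Pi.mul_apply, h2, hEq (h3 t ht).2]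
  simp only [gradTerm, queryRV, Input.query, hShrunk, S]
  change _ = p.k / p.δ * F (shrink p.c p.r p.δ (hMap (Z t ω) (unshrink p.c p.r p.δ
    (p.iter (fun s => Z s ω) (fun s => U s ω) (fun s => O s ω) t))) + p.δ • U t ω) * _
  ring

theorem continuous_gradTerm_sub (p : Input d) {F : Vec d → ℝ} (hF : Continuous F) (y : Vec d) :
    Continuous fun a : Vec d × ℝ × Vec d =>
      gradTerm p F (y - a.1) (unshrink p.c p.r p.δ a.1) a.2 := by
  have h1 : Continuous fun a : Vec d × ℝ × Vec d => unshrink p.c p.r p.δ a.1 :=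
      (continuous_unshrink p.c p.r p.δ).comp continuous_fst
  have h2 : Continuous fun a : Vec d × ℝ × Vec d => (y - a.1, unshrink p.c p.r p.δ a.1, a.2) :=
      (by fun_prop : Continuous fun a : Vec d × ℝ × Vec d => y - a.1).prodMk
        (h1.prodMk continuous_snd)
  have h3 := (continuous_gradTerm p hF).comp h2
  exact h3

/-- The samples of a round are independent of the current point. -/
theorem IsRun.integral_comp_eq (hR : IsRun p f P Z U O) (hp : p.Valid) [IsProbabilityMeasure P]
    {t : ℕ} (ht : t < p.T) {G : Vec d × ℝ × Vec d → ℝ} (hG : Continuous G) {B : ℝ}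
    (hB : ∀ x ∈ p.dom, ∀ q : ℝ × Vec d, q.1 ∈ Set.Icc (0 : ℝ) 1 → ‖q.2‖ = 1 → ‖G (x, q)‖ ≤ B) :
    Integrable (fun ω => ∫ q, G (iterRV p Z U O t ω, q)
      ∂(bqndLaw.prod (uniformSphere p.L₀))) P ∧
    ∫ ω, G (iterRV p Z U O t ω, Z t ω, U t ω) ∂P =
      ∫ ω, ∫ q, G (iterRV p Z U O t ω, q) ∂(bqndLaw.prod (uniformSphere p.L₀)) ∂P := by
  have := hp.nontrivial_L₀
  have := isProbabilityMeasure_uniformSphere p.L₀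
  have hXm := hR.measurable_iterRV hp ht.le
  have := Measure.isProbabilityMeasure_map (μ := P) hXm.aemeasurable
  have hGi : Integrable G ((P.map (iterRV p Z U O t)).prod
      (bqndLaw.prod (uniformSphere p.L₀))) := by
    refine Integrable.of_bound (C := B) hG.aestronglyMeasurable ?_
    have h1 : ∀ᵐ x ∂(P.map (iterRV p Z U O t)), x ∈ p.dom := by
      have hm : MeasurableSet {x | x ∈ p.dom} := hp.isCompact_dom.isClosed.measurableSet
      exact (ae_map_iff hXm.aemeasurable hm).2 (.of_forall fun ω => hp.iter_mem _ _ _ t)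
    filter_upwards [Measure.quasiMeasurePreserving_fst.ae h1,
      Measure.quasiMeasurePreserving_snd.ae (DRSub.ae_sample p.L₀)] with a ha1 ha2
    exact hB _ ha1 _ ha2.1 ha2.2.2
  have h3 : Integrable (fun x => ∫ q, G (x, q) ∂(bqndLaw.prod (uniformSphere p.L₀)))
      (P.map (iterRV p Z U O t)) := hGi.integral_prod_left
  refine ⟨h3.comp_measurable hXm, ?_⟩
  have h4 := integral_map (μ := P) (hXm.prodMk (hR.measurable_sample ht)).aemeasurable
    (f := G) hG.aestronglyMeasurable
  rw [← h4, hR.map_prod hp ht, integral_prod _ hGi,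
    integral_map hXm.aemeasurable h3.aestronglyMeasurable]

/-- A bound at each fixed point x integrates to one at the random x_t, because the fresh samples are
independent of it. -/
theorem IsRun.sub_integral_action_le (hR : IsRun p f P Z U O) (hp : p.Valid)
    [IsProbabilityMeasure P] {t : ℕ} (ht : t < p.T) {F : Vec d → ℝ} (hFc : Continuous F)
    (hEq : Set.EqOn (f t) F p.K) {y : Vec d} (hy : y ∈ p.K) {a : ℝ}
    (hpt : ∀ x ∈ p.dom, a - f t (hShrunk p.c p.r p.δ 1 x) ≤ (1 - Real.exp (-1)) *
      ∫ q, gradTerm p F (y - x) (unshrink p.c p.r p.δ x) q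
        ∂(bqndLaw.prod (uniformSphere p.L₀))) :
    a - ∫ ω, f t (actionRV p Z U O t ω) ∂P ≤
      (1 - Real.exp (-1)) * ∫ ω, inner ℝ (gradRV p Z U O t ω) (y - iterRV p Z U O t ω) ∂P := by
  rw [hR.integral_inner_eq hp ht hEq hy]
  obtain ⟨B, hB⟩ := hp.exists_abs_gradTerm_le hFc (isCompact_closedBall (0 : Vec d) (√d))
  have hGB : ∀ x ∈ p.dom, ∀ q : ℝ × Vec d, q.1 ∈ Set.Icc (0 : ℝ) 1 → ‖q.2‖ = 1 →
      ‖gradTerm p F (y - x) (unshrink p.c p.r p.δ x) q‖ ≤ B := fun x hx q h1 h2 => by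
    refine hB (y - x) ?_ _ (hp.unshrink_mem hx) q h1 h2
    rw [mem_closedBall_zero_iff]
    exact norm_sub_le_sqrt (hp.sub_cube hy) (hp.sub_cube (hp.dom_subset hx))
  obtain ⟨h3, h2⟩ := hR.integral_comp_eq hp ht (continuous_gradTerm_sub p hFc y) hGB
  have hact := hR.integrable_action hp hFc ht hEq
  rw [h2, ← integral_const_mul]
  have h4 : a - ∫ ω, f t (actionRV p Z U O t ω) ∂P =
      ∫ ω, (a - f t (actionRV p Z U O t ω)) ∂P := by
    rw [integral_sub (integrable_const _) hact]
    simp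
  rw [h4]
  exact integral_mono ((integrable_const _).sub hact) (h3.const_mul _)
    fun ω => hpt (iterRV p Z U O t ω) (hp.iter_mem _ _ _ t)

theorem IsRun.integral_inner_ge (hR : IsRun p f P Z U O) (hp : p.Valid) [IsProbabilityMeasure P]
    {M₁ : ℝ} {t : ℕ} (ht : t < p.T) (hf : IsDRSubmodular p.K M₁ (f t))
    {y : Vec d} (hy : y ∈ p.K) :
    Real.exp (-1) * f t y - shrinkLoss p M₁ - ∫ ω, f t (actionRV p Z U O t ω) ∂P ≤
      (1 - Real.exp (-1)) * ∫ ω, inner ℝ (gradRV p Z U O t ω)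
        (shrink p.c p.r p.δ (p.c + (1 - p.ε / p.rDom) • (y - p.c)) - iterRV p Z U O t ω) ∂P := by
  obtain ⟨F, hF, hEq⟩ := hf.exists_extension hp.sub_cube hp.convex ⟨_, hp.c_mem⟩
  refine hR.sub_integral_action_le hp ht hF.continuous hEq (hp.shrink_mem (hp.pull_mem hy))
    fun x hx => ?_
  have := hp.linearization hf hF hEq hy (hp.unshrink_mem hx)
  rw [hp.shrink_unshrink, sub_right_comm] at this
  exact this

/-- One step of online gradient ascent. -/
theorem IsRun.two_mul_integral_inner_le (hR : IsRun p f P Z U O) (hp : p.Valid)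
    [IsProbabilityMeasure P] {y : Vec d} (hy : y ∈ p.K) (hdeep : IsDeep p.dom p.ε y) {t : ℕ}
    (ht : t < p.T) :
    2 * p.η * ∫ ω, inner ℝ (gradRV p Z U O t ω) (y - iterRV p Z U O t ω) ∂P ≤
      ∫ ω, ‖y - iterRV p Z U O t ω‖ ^ 2 ∂P - ∫ ω, ‖y - iterRV p Z U O (t + 1) ω‖ ^ 2 ∂P +
        p.η ^ 2 * p.B₁ ^ 2 := by
  have hsq : ∀ s ≤ p.T, Integrable (fun ω => ‖y - iterRV p Z U O s ω‖ ^ 2) P := by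
    intro s hs
    refine Integrable.of_bound (C := √d ^ 2)
      ((measurable_const.sub (hR.measurable_iterRV hp hs)).norm.pow_const 2).aestronglyMeasurable
      (.of_forall fun ω => ?_)
    rw [Real.norm_of_nonneg (sq_nonneg _)]
    exact pow_le_pow_left₀ (norm_nonneg _) (norm_sub_iterRV_le hp hy s ω) 2
  have h1 := hsq t ht.le
  have h2 := hsq (t + 1) ht
  have h3 : (∫ ω, ‖y - iterRV p Z U O t ω‖ ^ 2 ∂P) - ∫ ω, ‖y - iterRV p Z U O (t + 1) ω‖ ^ 2 ∂P +
      p.η ^ 2 * p.B₁ ^ 2 = ∫ ω, (‖y - iterRV p Z U O t ω‖ ^ 2 -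
        ‖y - iterRV p Z U O (t + 1) ω‖ ^ 2 + p.η ^ 2 * p.B₁ ^ 2) ∂P := by
    have h4 := integral_add (μ := P) (f := fun ω => ‖y - iterRV p Z U O t ω‖ ^ 2 -
      ‖y - iterRV p Z U O (t + 1) ω‖ ^ 2) (h1.sub h2) (integrable_const (p.η ^ 2 * p.B₁ ^ 2))
    rw [h4, integral_sub h1 h2]
    simp
  rw [h3, ← integral_const_mul]
  refine integral_mono_ae ((hR.integrable_inner hp hy ht).const_mul _)
    ((h1.sub h2).add (integrable_const _)) ?_
  filter_upwards [hR.norm_gradRV_le hp ht] with ω hω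
  have h4 := norm_soip_sub_le hp.isCompact_dom.isBounded hp.nontrivial_dom hp.oracle hp.ε_pos
    hp.c_mem_dom hdeep (iterRV p Z U O t ω + p.η • gradRV p Z U O t ω)
  rw [← iterRV_succ] at h4
  have h5 := pow_le_pow_left₀ (norm_nonneg _) h4 2
  have h6 : iterRV p Z U O t ω + p.η • gradRV p Z U O t ω - y =
      p.η • gradRV p Z U O t ω - (y - iterRV p Z U O t ω) := by abel
  rw [h6, norm_sub_sq_real (p.η • gradRV p Z U O t ω), norm_smul, mul_pow, inner_smul_left,
    Real.norm_eq_abs, sq_abs, norm_sub_rev (iterRV p Z U O (t + 1) ω)] at h5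
  have h7 := mul_le_mul_of_nonneg_left (pow_le_pow_left₀ (norm_nonneg _) hω 2) (sq_nonneg p.η)
  simp only [conj_trivial] at h5
  linarith

end Run

/-! ### Summation over rounds and choice of parameters. -/

section Regret

/-- A positive lower bound for `r - n ^ (-1/4)`, uniform over all `n` for which it is positive. -/
theorem exists_pos_le_sub_rpow (r : ℝ) : ∃ r₀ : ℝ, 0 < r₀ ∧
    ∀ n : ℕ, 1 ≤ n → (n : ℝ) ^ (-(1 / 4) : ℝ) < r → r₀ ≤ r - (n : ℝ) ^ (-(1 / 4) : ℝ) := by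
  classical
  by_cases h : ∃ n : ℕ, 1 ≤ n ∧ (n : ℝ) ^ (-(1 / 4) : ℝ) < r
  -- The gap increases with n, so the smallest admissible n gives the bound.
  · refine ⟨r - (Nat.find h : ℝ) ^ (-(1 / 4) : ℝ), sub_pos.2 (Nat.find_spec h).2,
      fun n h1 h2 => sub_le_sub_left ?_ r⟩
    refine Real.rpow_le_rpow_of_nonpos ?_ ?_ (by norm_num)
    · exact_mod_cast (Nat.find_spec h).1
    · exact_mod_cast Nat.find_min' h ⟨h1, h2⟩
  · exact ⟨1, one_pos, fun n h1 h2 => absurd ⟨n, h1, h2⟩ h⟩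

/-- The constant of the regret bound. -/
def regretConst (d : ℕ) (r v M₁ B₀ r₀ : ℝ) : ℝ :=
  M₁ * √d * (1 / r + v / r₀) + M₁ + d * d * B₀ / (v * r₀) + v * r * d * B₀ / 4

variable {p : Input d}

theorem Input.k_le (p : Input d) : p.k ≤ d := by
  simpa [Input.k] using Submodule.finrank_le p.L₀

theorem Input.Valid.k_pos (hp : p.Valid) : 0 < (p.k : ℝ) := by
  have := hp.nontrivial_L₀
  exact_mod_cast Module.finrank_pos (R := ℝ) (M := p.L₀)

theorem Input.Valid.B₁_pos (hp : p.Valid) : 0 < p.B₁ :=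
  mul_pos (div_pos hp.k_pos hp.δ_pos) hp.B₀_pos

theorem Input.Valid.η_pos (hp : p.Valid) : 0 < p.η := by
  have hT : (0 : ℝ) < p.T := by exact_mod_cast hp.T_pos
  have := hp.v_pos
  have := hp.rDom_pos
  have := hp.B₁_pos
  unfold Input.η
  positivity

/-- In terms of s = T^{1/4}, the terms Tδ, 1/η and TηB₁² are all of order s³. -/
theorem Input.Valid.loss_le (hp : p.Valid) {M₁ r₀ : ℝ} (hM : 0 ≤ M₁) (hr₀ : 0 < r₀)
    (hle : r₀ ≤ p.rDom) :
    p.T * shrinkLoss p M₁ + (d / (2 * p.η) + p.T * p.η * p.B₁ ^ 2 / 2) ≤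
      regretConst d p.r p.v M₁ p.B₀ r₀ * (p.T : ℝ) ^ (3 / 4 : ℝ) := by
  have hT1 : (1 : ℝ) ≤ p.T := by exact_mod_cast hp.T_pos
  have hT : (0 : ℝ) < p.T := zero_lt_one.trans_le hT1
  have hr := hp.r_pos
  have hv := hp.v_pos
  have hB := hp.B₀_pos
  have hR := hp.rDom_pos
  have hRr : p.rDom ≤ p.r := by rw [Input.rDom]; linarith [hp.δ_pos]
  have hk := hp.k_pos
  have hkd : (p.k : ℝ) ≤ d := by exact_mod_cast p.k_le
  set s : ℝ := (p.T : ℝ) ^ (1 / 4 : ℝ) with hs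
  have hs1 : 1 ≤ s := Real.one_le_rpow hT1 (by norm_num)
  have hs0 : 0 < s := zero_lt_one.trans_le hs1
  have hTs : (p.T : ℝ) = s ^ 4 := by
    rw [hs, ← Real.rpow_natCast, ← Real.rpow_mul hT.le]; norm_num
  have h34 : (p.T : ℝ) ^ (3 / 4 : ℝ) = s ^ 3 := by
    rw [hs, ← Real.rpow_natCast, ← Real.rpow_mul hT.le]; norm_num
  have hδ : p.δ = s⁻¹ := by rw [Input.δ, hs, Real.rpow_neg hT.le]
  have h12 : (p.T : ℝ) ^ (-(1 / 2) : ℝ) = (s ^ 2)⁻¹ := by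
    rw [Real.rpow_neg hT.le, hs, ← Real.rpow_natCast, ← Real.rpow_mul hT.le]; norm_num
  have hε : p.ε = p.v * (s ^ 2)⁻¹ := by rw [Input.ε, h12]
  have hB₁ : p.B₁ = p.k * s * p.B₀ := by rw [Input.B₁, hδ, div_inv_eq_mul]
  have hη : p.η = p.v * p.rDom / (2 * (p.k * s * p.B₀)) * (s ^ 2)⁻¹ := by
    rw [Input.η, h12, hB₁]
  have h1 : p.T * shrinkLoss p M₁ ≤ (M₁ * √d * (1 / p.r + p.v / r₀) + M₁) * s ^ 3 := by
    have e1 : s ^ 4 * shrinkLoss p M₁ =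
        (M₁ * √d * (1 / p.r + p.v / (s * p.rDom)) + M₁) * s ^ 3 := by
      rw [shrinkLoss, hδ, hε]; field_simp
    rw [hTs, e1]
    -- The ε-loss is only of order s²; the spare factor s ≥ 1 is given away.
    have e2 : r₀ ≤ s * p.rDom := hle.trans (le_mul_of_one_le_left hR.le hs1)
    have e3 : p.v / (s * p.rDom) ≤ p.v / r₀ := div_le_div_of_nonneg_left hv.le hr₀ e2
    gcongr
  have h2 : d / (2 * p.η) ≤ d * d * p.B₀ / (p.v * r₀) * s ^ 3 := by
    have e1 : d / (2 * p.η) = d * p.k * p.B₀ / (p.v * p.rDom) * s ^ 3 := by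
      rw [hη]; field_simp
    rw [e1]
    gcongr
  have h3 : p.T * p.η * p.B₁ ^ 2 / 2 ≤ p.v * p.r * d * p.B₀ / 4 * s ^ 3 := by
    have e1 : p.T * p.η * p.B₁ ^ 2 / 2 = p.v * p.rDom * p.k * p.B₀ / 4 * s ^ 3 := by
      rw [hη, hB₁, hTs]; field_simp; norm_num
    rw [e1]
    gcongr
  rw [h34, regretConst]
  linarith

variable {Ω : Type*} [MeasurableSpace Ω] {f : ℕ → Vec d → ℝ} {P : Measure Ω}
  {Z : ℕ → Ω → ℝ} {U : ℕ → Ω → Vec d} {O : ℕ → Ω → ℝ}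

/-- The linear regret of SO-OGA against a deep point. -/
theorem IsRun.sum_integral_inner_le (hR : IsRun p f P Z U O) (hp : p.Valid)
    [IsProbabilityMeasure P] {y : Vec d} (hy : y ∈ p.K) (hdeep : IsDeep p.dom p.ε y)
    {a b : ℕ} (hab : a ≤ b) (hb : b ≤ p.T) :
    ∑ t ∈ Finset.Ico a b,
      ∫ ω, inner ℝ (gradRV p Z U O t ω) (y - iterRV p Z U O t ω) ∂P ≤
        d / (2 * p.η) + p.T * p.η * p.B₁ ^ 2 / 2 := by
  have hη := hp.η_pos
  let V : ℕ → ℝ := fun t => ∫ ω, ‖y - iterRV p Z U O t ω‖ ^ 2 ∂P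
  have h1 : 2 * p.η * ∑ t ∈ Finset.Ico a b,
      ∫ ω, inner ℝ (gradRV p Z U O t ω) (y - iterRV p Z U O t ω) ∂P ≤
      ∑ t ∈ Finset.Ico a b, (V t - V (t + 1) + p.η ^ 2 * p.B₁ ^ 2) := by
    rw [Finset.mul_sum]
    exact Finset.sum_le_sum fun t ht => hR.two_mul_integral_inner_le hp hy hdeep
      ((Finset.mem_Ico.1 ht).2.trans_le hb)
  have h2 : ∑ t ∈ Finset.Ico a b, (V t - V (t + 1)) = V a - V b := by
    have := Finset.sum_Ico_sub V hab
    rw [← neg_sub (V b), ← this, ← Finset.sum_neg_distrib]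
    exact Finset.sum_congr rfl fun t _ => by ring
  rw [Finset.sum_add_distrib, h2, Finset.sum_const, Nat.card_Ico, nsmul_eq_mul] at h1
  -- This holds for every starting round a, so intervals cost no more than the whole horizon.
  have h3 : V a ≤ d := by
    have : V a ≤ ∫ _ω, (d : ℝ) ∂P := by
      refine integral_mono_of_nonneg (.of_forall fun ω => sq_nonneg _) (integrable_const _)
        (.of_forall fun ω => ?_)
      have := pow_le_pow_left₀ (norm_nonneg _)
        (norm_sub_iterRV_le (Z := Z) (U := U) (O := O) hp hy a ω) 2
      rwa [Real.sq_sqrt (Nat.cast_nonneg d)] at this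
    simpa using this
  have h4 : 0 ≤ V b := integral_nonneg fun ω => sq_nonneg _
  have h5 : ((b - a : ℕ) : ℝ) ≤ p.T := by exact_mod_cast (Nat.sub_le b a).trans hb
  have h6 : ((b - a : ℕ) : ℝ) * (p.η ^ 2 * p.B₁ ^ 2) ≤ p.T * (p.η ^ 2 * p.B₁ ^ 2) := by gcongr
  have h7 : d / (2 * p.η) + p.T * p.η * p.B₁ ^ 2 / 2 =
      (d + p.T * (p.η ^ 2 * p.B₁ ^ 2)) / (2 * p.η) := by field_simp
  rw [h7, le_div_iff₀ (by positivity), mul_comm]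
  linarith

theorem IsRun.regret_Ico_le (hR : IsRun p f P Z U O) (hp : p.Valid) [IsProbabilityMeasure P]
    {M₁ r₀ : ℝ} (hf : ∀ t < p.T, IsDRSubmodular p.K M₁ (f t)) (hr₀ : 0 < r₀) (hle : r₀ ≤ p.rDom)
    {a b : ℕ} (hab : a ≤ b) (hb : b ≤ p.T) :
    regret (Real.exp (-1)) p.K f P (actionRV p Z U O) (Finset.Ico a b) ≤
      regretConst d p.r p.v M₁ p.B₀ r₀ * (p.T : ℝ) ^ (3 / 4 : ℝ) := by
  have hne : p.K.Nonempty := ⟨_, hp.c_mem⟩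
  have hM : 0 ≤ M₁ := (hf 0 hp.T_pos).nonneg_bound hne
  have hloss : 0 ≤ shrinkLoss p M₁ := by
    have := hp.δ_pos
    have := hp.ratio_pos
    have := div_pos hp.ε_pos hp.rDom_pos
    unfold shrinkLoss
    positivity
  have he := one_sub_exp_neg_one_pos
  refine le_trans ?_ (hp.loss_le hM hr₀ hle)
  -- Dividing by e^{-1} isolates the supremum, so that one comparator can be treated at a time.
  rw [regret, sub_le_iff_le_add, ← le_div_iff₀' (Real.exp_pos _)]
  refine csSup_le (hne.image _) ?_
  rintro _ ⟨y, hy, rfl⟩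
  rw [le_div_iff₀' (Real.exp_pos _)]
  have h1 := Finset.sum_le_sum fun t (ht : t ∈ Finset.Ico a b) =>
    hR.integral_inner_ge hp ((Finset.mem_Ico.1 ht).2.trans_le hb)
      (hf t ((Finset.mem_Ico.1 ht).2.trans_le hb)) hy
  rw [← Finset.mul_sum, Finset.sum_sub_distrib, Finset.sum_sub_distrib, ← Finset.mul_sum,
    Finset.sum_const, Nat.card_Ico, nsmul_eq_mul] at h1
  have h2 := hR.sum_integral_inner_le hp (hp.shrink_mem (hp.pull_mem hy)) (hp.isDeep hy) hab hb
  have h3 : 0 ≤ d / (2 * p.η) + p.T * p.η * p.B₁ ^ 2 / 2 := by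
    have := hp.η_pos
    positivity
  have h4 := mul_le_mul_of_nonneg_left h2 he.le
  have h5 : (1 - Real.exp (-1)) * (d / (2 * p.η) + p.T * p.η * p.B₁ ^ 2 / 2) ≤
      d / (2 * p.η) + p.T * p.η * p.B₁ ^ 2 / 2 :=
    mul_le_of_le_one_left h3 (by linarith [Real.exp_pos (-1)])
  have h6 : ((b - a : ℕ) : ℝ) * shrinkLoss p M₁ ≤ p.T * shrinkLoss p M₁ :=
    mul_le_mul_of_nonneg_right (by exact_mod_cast (Nat.sub_le b a).trans hb) hloss
  linarith

end Regret

end DRSub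
end

theorem proposition5 (d : ℕ) (r v M₁ B₀ : ℝ) (hr : 0 < r) (hv : 0 < v) (hB₀ : 0 < B₀) :
    ∃ C : ℝ, ∀ p : DRSub.Input d, p.r = r → p.v = v → p.B₀ = B₀ →
      p.K ⊆ DRSub.unitCube d → IsClosed p.K → Convex ℝ p.K → DRSub.IsDownClosed p.K →
      p.K.Nontrivial → p.c ∈ p.K →
      Metric.closedBall p.c r ∩ (affineSpan ℝ p.K : Set (DRSub.Vec d)) ⊆ p.K →
      1 ≤ p.T → p.δ < r → p.ε < p.rDom → DRSub.IsSeparationOracle p.dom p.so →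
      ∀ f : ℕ → DRSub.Vec d → ℝ, (∀ t < p.T, DRSub.IsDRSubmodular p.K M₁ (f t)) →
      ∀ (Ω : Type*) [MeasurableSpace Ω] (P : MeasureTheory.Measure Ω)
        [MeasureTheory.IsProbabilityMeasure P]
        (Z : ℕ → Ω → ℝ) (U : ℕ → Ω → DRSub.Vec d) (O : ℕ → Ω → ℝ),
        DRSub.IsRun p f P Z U O →
        (∀ᵐ ω ∂P, ∀ t < p.T,
          DRSub.actionRV p Z U O t ω ∈ p.K ∧ DRSub.queryRV p Z U O t ω ∈ p.K) ∧
        (∀ t < p.T, MeasureTheory.Integrable (fun ω => f t (DRSub.actionRV p Z U O t ω)) P) ∧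
        DRSub.staticRegret (Real.exp (-1)) p.K f P (DRSub.actionRV p Z U O) p.T
          ≤ C * (p.T : ℝ) ^ (3 / 4 : ℝ) ∧
        DRSub.adaptiveRegret (Real.exp (-1)) p.K f P (DRSub.actionRV p Z U O) p.T
          ≤ C * (p.T : ℝ) ^ (3 / 4 : ℝ) := by
  -- The bound involves 1/rDom, which depends on T; r₀ depends on r alone and keeps the constant
  -- uniform.
  obtain ⟨r₀, hr₀, hlow⟩ := DRSub.exists_pos_le_sub_rpow r
  refine ⟨DRSub.regretConst d r v M₁ B₀ r₀, ?_⟩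
  rintro p rfl rfl rfl hK hcl hcv hdown hnt hc hball hT hδ hε hso f hf Ω _ P _ Z U O hR
  have hp : p.Valid := ⟨hr, hv, hB₀, hK, hcl, hcv, hdown, hnt, hc, hball, hT, hδ, hε, hso⟩
  have hle : r₀ ≤ p.rDom := hlow p.T hT hδ
  refine ⟨hR.ae_mem hp, fun t ht => ?_, ?_, ?_⟩
  · obtain ⟨F, hF, hEq⟩ := (hf t ht).exists_extension hK hcv ⟨_, hc⟩
    exact hR.integrable_action hp hF.continuous ht hEq
  · rw [DRSub.staticRegret, Finset.range_eq_Ico]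
    exact hR.regret_Ico_le hp hf hr₀ hle (Nat.zero_le _) le_rfl
  -- The one-round interval at 0 shows that the set of regrets is nonempty.
  · refine csSup_le ⟨_, 0, 0, le_rfl, hT, rfl⟩ ?_
    rintro _ ⟨s, e, hse, heT, rfl⟩
    have : Finset.Icc s e = Finset.Ico s (e + 1) := by
      ext i; simp
    rw [this]
    exact hR.regret_Ico_le hp hf hr₀ hle (by omega) heT
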